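/- All graphs are finite, simple and undirected. A connected dominating set of a graph $G$ is a set $D$ of vertices such that every vertex of $G$ lies in $D$ or is adjacent to a vertex of $D$, and such that the induced subgraph $G[D]$ is connected (in particular $D\neq\emptyset$). The connected domination number $\gamma_c(G)$ is the minimum cardinality of a connected dominating set, with $\gamma_c(G)=\infty$ if there is none. The connectivity $\kappa(G)$ is the minimum cardinality of a set $S$ of vertices such that $G-S$ is disconnected, or, if $G$ is complete, $\kappa(G)=|V(G)|-1$. Let $\delta(G)$ be the minimum degree and $\alpha(G)$ the maximum cardinality of a set of pairwise non-adjacent vertices. A graph $G$ is called maximal $3$-$\gamma_c$-vertex critical if it is $2$-connected (that is, $\kappa(G)\ge 2$), $\gamma_c(G)=3$, $\gamma_c(G+uv)<3$ for every pair of distinct non-adjacent vertices $u,v$ of $G$, and $\gamma_c(G-v)<3$ for every vertex $v$ of $G$. **Corollary 4.6.** Let $G$ be a maximal $3$-$\gamma_c$-vertex critical graph. If $\alpha(G)=\kappa(G)$, then $\kappa(G)=\delta(G)$. -/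

import Mathlib

namespace SimpleGraph

variable {V : Type*}

/-- `D` dominates `G`: every vertex lies in `D` or is adjacent to a vertex of `D`. -/
def IsDominatingSet (G : SimpleGraph V) (D : Finset V) : Prop :=
  ∀ v : V, v ∈ D ∨ ∃ d ∈ D, G.Adj v d

/-- A connected dominating set: a dominating set `D` such that the induced subgraph `G[D]` is
connected (so, in particular, `D` is nonempty). -/
def IsConnectedDominatingSet (G : SimpleGraph V) (D : Finset V) : Prop :=
  G.IsDominatingSet D ∧ (G.induce (D : Set V)).Connected

/-- The connected domination number `γ_c(G)`: the least cardinality of a connected dominating set.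
It is `⊤` exactly when there is no (finite) connected dominating set, for instance when `G` is
disconnected. -/
noncomputable def connectedDominationNumber (G : SimpleGraph V) : ℕ∞ :=
  ⨅ (D : Finset V) (_ : G.IsConnectedDominatingSet D), (D.card : ℕ∞)

/-- A vertex cut set: a set `S` of vertices such that `G - S` is disconnected (two of its vertices
are not joined by a walk). -/
def IsVertexCutSet (G : SimpleGraph V) (S : Finset V) : Prop :=
  ¬ (G.induce ((S : Set V)ᶜ)).Preconnected

/-- The connectivity `κ(G)` of a finite graph: the least cardinality of a set `S` of vertices
such that `G - S` is disconnected or has at most one vertex. If `G` is not complete this is the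
least cardinality of a vertex cut set; the second alternative is the usual convention
`κ(K_n) = n - 1` for complete graphs, which have no vertex cut set. -/
noncomputable def vertexConnectivity (G : SimpleGraph V) : ℕ :=
  sInf {n | ∃ S : Finset V, S.card = n ∧
    (G.IsVertexCutSet S ∨ ((S : Set V)ᶜ).Subsingleton)}

/-- `G` is `k`-`γ_c`-edge critical: `γ_c(G) = k`, and `γ_c(G + uv) < k` for every pair of
distinct non-adjacent vertices `u`, `v`. -/
def IsEdgeCritical (G : SimpleGraph V) (k : ℕ) : Prop :=
  G.connectedDominationNumber = k ∧
    ∀ u v : V, u ≠ v → ¬ G.Adj u v → (G ⊔ edge u v).connectedDominationNumber < k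

/-- `G` is `k`-`γ_c`-vertex critical: `G` is 2-connected, `γ_c(G) = k`, and `γ_c(G - v) < k` for
every vertex `v`. -/
def IsVertexCritical (G : SimpleGraph V) (k : ℕ) : Prop :=
  2 ≤ G.vertexConnectivity ∧ G.connectedDominationNumber = k ∧
    ∀ v : V, (G.induce ({v}ᶜ : Set V)).connectedDominationNumber < k

/-- `G` is maximal `k`-`γ_c`-vertex critical: both `k`-`γ_c`-edge critical and
`k`-`γ_c`-vertex critical. -/
def IsMaximalVertexCritical (G : SimpleGraph V) (k : ℕ) : Prop :=
  G.IsEdgeCritical k ∧ G.IsVertexCritical k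

end SimpleGraph

/-! Suppose `κ < δ`, and let `S` be a minimum cut, with no edges between the sides `A` and `B` of `G
- S`. Say that `u` beats `v` through `w` when `DominatesAllBut u w v`. Vertex criticality gives for
each `v` an adjacent pair dominating all but `v` (below, the pair of `v`); an adjacent pair outside
`S` lies on one side and cannot reach the other, so the pair contains a vertex of `S` not adjacent
to `v` (`exists_mem_dominatesAllBut`). By edge criticality, of two distinct nonadjacent vertices one
beats the other, unless the two together dominate `G` (`trichotomy`).

Let `I` be independent with `|I| = |S| ≥ 3`. Two members of `I` never dominate a third, so one beats
the other, through a vertex `w` adjacent to all of `I` but the beaten one (`MissesOnly`); if the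
winner is outside `S`, then `w ∈ S \ I`. Such a `w` serves only one beaten vertex, at most one
vertex of `I \ S` goes without a witness, and `|S \ I| = |I \ S|`. Hence the witnesses fill `S \ I`,
up to at most one place. This determines which cut vertices can miss a given vertex outside `S`, and
contradicts its pair, the minimality of `S` or `κ < δ`. The cases in `elim` depend on how `I` is
spread over `S`, `A`, `B` and on whether a witness is lacking. If `|S| = 2`, there are three
independent vertices, against `α = κ`. -/

namespace SimpleGraph
variable {V : Type*}

/-! ### Criticality expressed by dominating pairs -/

/-- The adjacent vertices `x`, `y` together dominate every vertex except `v`. -/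
def DominatesAllBut (G : SimpleGraph V) (x y v : V) : Prop :=
  G.Adj x y ∧ x ≠ v ∧ y ≠ v ∧ ¬ G.Adj x v ∧ ¬ G.Adj y v ∧
    ∀ t, t ≠ v → t = x ∨ t = y ∨ G.Adj x t ∨ G.Adj y t

theorem DominatesAllBut.symm {G : SimpleGraph V} {x y v : V} (h : G.DominatesAllBut x y v) :
    G.DominatesAllBut y x v := by
  obtain ⟨h1, h2, h3, h4, h5, h6⟩ := h
  exact ⟨h1.symm, h3, h2, h5, h4, fun t ht => by have := h6 t ht; tauto⟩

theorem exists_pair_of_connectedDominationNumber_lt_three {G : SimpleGraph V}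
    (h : G.connectedDominationNumber < 3) :
    ∃ x y, (x = y ∨ G.Adj x y) ∧ ∀ t, t = x ∨ t = y ∨ G.Adj x t ∨ G.Adj y t := by
  classical
  unfold connectedDominationNumber at h
  simp only [iInf_lt_iff] at h
  obtain ⟨D, ⟨hdom, hconn⟩, hD⟩ := h
  have hD2 : D.card < 3 := by exact_mod_cast hD
  obtain ⟨⟨x, hx⟩⟩ := hconn.nonempty
  have hx : x ∈ D := by simpa using hx
  rcases Nat.lt_or_ge D.card 2 with h1 | h2
  · have : D = {x} := by
      apply Finset.eq_singleton_iff_unique_mem.2 ⟨hx, fun y hy => ?_⟩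
      exact Finset.card_le_one.1 (by omega) y hy x hx
    subst this
    refine ⟨x, x, Or.inl rfl, fun t => ?_⟩
    have := hdom t
    simp [G.adj_comm t] at this
    tauto
  · obtain ⟨a, b, hab, rfl⟩ := Finset.card_eq_two.1 (show D.card = 2 by omega)
    refine ⟨a, b, Or.inr ?_, fun t => ?_⟩
    · have : Nontrivial (({a, b} : Finset V) : Set V) :=
        ⟨⟨⟨a, by simp⟩, ⟨b, by simp⟩, by simpa using hab⟩⟩
      obtain ⟨⟨c, hc⟩, hadj⟩ := hconn.preconnected.exists_adj_of_nontrivial ⟨a, by simp⟩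
      have hadj : G.Adj a c := hadj
      have hc : c = a ∨ c = b := by simpa using hc
      rcases hc with rfl | rfl
      · exact absurd hadj (G.irrefl)
      · exact hadj
    · have := hdom t
      simp [G.adj_comm t] at this
      tauto

theorem exists_not_dominated_of_adj {G : SimpleGraph V} (h : G.connectedDominationNumber = 3)
    {x y : V} (hxy : G.Adj x y) : ∃ v, v ≠ x ∧ v ≠ y ∧ ¬ G.Adj x v ∧ ¬ G.Adj y v := by
  classical
  by_contra! hcon
  have hD : G.IsConnectedDominatingSet {x, y} := by
    constructor
    · intro v
      have := hcon v
      simp only [Finset.mem_insert, Finset.mem_singleton, exists_eq_or_imp, exists_eq_left,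
        G.adj_comm v]
      tauto
    · have := induce_pair_connected_of_adj hxy
      rwa [← Finset.coe_pair] at this
  have h2 : G.connectedDominationNumber ≤ (({x, y} : Finset V).card : ℕ∞) :=
    iInf₂_le (f := fun (D : Finset V) (_ : G.IsConnectedDominatingSet D) => (D.card : ℕ∞)) _ hD
  rw [h, Finset.card_pair hxy.ne] at h2
  exact absurd h2 (by decide)

theorem IsVertexCritical.exists_dominatesAllBut {G : SimpleGraph V} (hG : G.IsVertexCritical 3)
    (hnbr : ∀ v, ∃ w, G.Adj v w) (v : V) : ∃ x y, G.DominatesAllBut x y v := by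
  obtain ⟨⟨x, hx⟩, ⟨y, hy⟩, hxy, hdom⟩ :=
    exists_pair_of_connectedDominationNumber_lt_three (hG.2.2 v)
  have hF := fun x y => exists_not_dominated_of_adj (G := G) hG.2.1 (x := x) (y := y)
  have hdom' : ∀ t, t ≠ v → t = x ∨ t = y ∨ G.Adj x t ∨ G.Adj y t := by
    intro t ht
    simpa [Subtype.ext_iff] using hdom ⟨t, ht⟩
  have hxy' : x = y ∨ G.Adj x y := by simpa using hxy
  have hx' : x ≠ v := hx
  have hy' : y ≠ v := hy
  obtain ⟨n, hn⟩ := hnbr v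
  -- If `x` alone dominates `G - v`, then `x` with a neighbour of `v`, or with `v` itself when `x`
  -- is that neighbour, is a connected dominating pair of `G`.
  rcases hxy' with rfl | hadj
  · exfalso
    by_cases hnx : n = x
    · subst hnx
      obtain ⟨t, ht⟩ := hF n v hn.symm
      grind
    · have : G.Adj x n := by have := hdom' n hn.ne'; grind
      obtain ⟨t, ht⟩ := hF x n this
      grind [SimpleGraph.adj_comm]
  · refine ⟨x, y, hadj, hx, hy, ?_, ?_, hdom'⟩
    · obtain ⟨t, ht⟩ := hF x y hadj
      grind
    · obtain ⟨t, ht⟩ := hF x y hadj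
      grind

/-- Take a pair dominating `G + uv`. If it is an edge of `G`, a vertex it leaves undominated in `G`
is reached only through `uv`, so it is one of `u`, `v` and the other is in the pair. If it is the
new edge, `u` and `v` dominate `G`. A single vertex could be completed to a dominating edge of `G`.
-/
theorem IsEdgeCritical.dominates_or_dominatesAllBut {G : SimpleGraph V} (hG : G.IsEdgeCritical 3)
    (hnbr : ∀ v, ∃ w, G.Adj v w) {u v : V} (huv : u ≠ v) (hadj : ¬ G.Adj u v) :
    (∀ t, t = u ∨ t = v ∨ G.Adj u t ∨ G.Adj v t) ∨ (∃ w, G.DominatesAllBut u w v) ∨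
      ∃ w, G.DominatesAllBut v w u := by
  obtain ⟨x, y, hxy, hdom⟩ :=
    exists_pair_of_connectedDominationNumber_lt_three (hG.2 u v huv hadj)
  have hF := fun x y => exists_not_dominated_of_adj (G := G) hG.1 (x := x) (y := y)
  have hsymm : ∀ a b, G.Adj a b → G.Adj b a := fun _ _ h => h.symm
  have hne : ∀ a b, G.Adj a b → a ≠ b := fun _ _ h => h.ne
  simp only [sup_adj, edge_adj] at hxy hdom
  by_cases hxyG : G.Adj x y
  · obtain ⟨t, ht⟩ := hF x y hxyG
    have h1 := hdom t
    have key : ∀ s, s ≠ t → s = x ∨ s = y ∨ G.Adj x s ∨ G.Adj y s := by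
      intro s hs
      have h2 := hdom s
      grind
    unfold DominatesAllBut
    have : (t = v ∧ (x = u ∨ y = u)) ∨ (t = u ∧ (x = v ∨ y = v)) := by grind
    rcases this with ⟨rfl, rfl | rfl⟩ | ⟨rfl, rfl | rfl⟩
    · exact Or.inr (Or.inl ⟨y, hxyG, ht.1.symm, ht.2.1.symm, ht.2.2.1, ht.2.2.2, key⟩)
    · exact Or.inr (Or.inl ⟨x, hxyG.symm, ht.2.1.symm, ht.1.symm, ht.2.2.2, ht.2.2.1,
        fun s hs => by have := key s hs; tauto⟩)
    · exact Or.inr (Or.inr ⟨y, hxyG, ht.1.symm, ht.2.1.symm, ht.2.2.1, ht.2.2.2, key⟩)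
    · exact Or.inr (Or.inr ⟨x, hxyG.symm, ht.2.1.symm, ht.1.symm, ht.2.2.2, ht.2.2.1,
        fun s hs => by have := key s hs; tauto⟩)
  · rcases hxy with rfl | h | h
    · exfalso
      have hd : ∀ z, G.Adj x z → ∃ t, t ≠ x ∧ t ≠ z ∧ ¬ G.Adj x t ∧ ¬ G.Adj z t := hF x
      have e : ∀ t, t ≠ u → t ≠ v → t = x ∨ G.Adj x t := by
        intro t _ _
        have := hdom t
        grind
      obtain ⟨n, hn⟩ := hnbr x
      obtain ⟨nu, hnu⟩ := hnbr u
      obtain ⟨nv, hnv⟩ := hnbr v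
      have hu := hdom u
      have hv := hdom v
      have hnu' := hdom nu
      have hnv' := hdom nv
      by_cases hxu : x = u
      · subst hxu
        have h3 : G.Adj x nv := by grind
        obtain ⟨t, ht⟩ := hd nv h3
        have := hdom t
        grind
      · by_cases hxv : x = v
        · subst hxv
          have h3 : G.Adj x nu := by grind
          obtain ⟨t, ht⟩ := hd nu h3
          have := hdom t
          grind
        · obtain ⟨t, ht⟩ := hd n hn
          have := hdom t
          grind
    · exact absurd h hxyG
    · left
      intro t
      have := hdom t
      grind

/-! ### Minimum cuts and the two sides -/

theorem isVertexCutSet_of_closed {G : SimpleGraph V} {T : Finset V} {A : V → Prop}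
    (hA : ∀ a b, A a → b ∉ T → G.Adj a b → A b) {u v : V} (hu : A u) (huT : u ∉ T)
    (hv : ¬ A v) (hvT : v ∉ T) : G.IsVertexCutSet T := by
  intro hpre
  obtain ⟨w⟩ := hpre ⟨u, by simpa using huT⟩ ⟨v, by simpa using hvT⟩
  have key : ∀ a b : ((T : Set V)ᶜ : Set V), (G.induce ((T : Set V)ᶜ)).Walk a b → A a → A b := by
    intro a b w
    induction w with
    | nil => exact id
    | @cons a b c hab _ ih => exact fun ha => ih (hA _ _ ha (fun h => b.2 h) hab)
  exact hv (key _ _ w hu)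

theorem vertexConnectivity_le {G : SimpleGraph V} {T : Finset V} (h : G.IsVertexCutSet T) :
    G.vertexConnectivity ≤ T.card :=
  Nat.sInf_le ⟨T, rfl, Or.inl h⟩


/-- A minimum cut `S` of a graph with connectivity below the minimum degree, separating `A` from
`B`, together with the criticality properties of the graph. -/
structure IsCriticalSeparation (G : SimpleGraph V) (S A B : Finset V) : Prop where
  cover : ∀ v, v ∈ S ∨ v ∈ A ∨ v ∈ B
  disj_left : ∀ v ∈ S, v ∉ A
  disj_right : ∀ v ∈ S, v ∉ B
  disj : ∀ v ∈ A, v ∉ B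
  not_adj : ∀ a ∈ A, ∀ b ∈ B, ¬ G.Adj a b
  exists_adj_left : ∀ x ∈ S, ∃ a ∈ A, G.Adj x a
  exists_adj_right : ∀ x ∈ S, ∃ b ∈ B, G.Adj x b
  card_left : 3 ≤ A.card
  card_right : 3 ≤ B.card
  card_lt : ∀ v, ∀ N : Finset V, (∀ t, G.Adj v t → t ∈ N) → S.card < N.card
  exists_dominatesAllBut : ∀ v, ∃ x y, G.DominatesAllBut x y v
  trichotomy : ∀ u v, u ≠ v → ¬ G.Adj u v → (∀ t, t = u ∨ t = v ∨ G.Adj u t ∨ G.Adj v t) ∨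
    (∃ w, G.DominatesAllBut u w v) ∨ ∃ w, G.DominatesAllBut v w u

theorem exists_isCriticalSeparation [Fintype V] {G : SimpleGraph V} [DecidableRel G.Adj]
    (hG : G.IsMaximalVertexCritical 3) (hlt : G.vertexConnectivity < G.minDegree) :
    ∃ S A B : Finset V, S.card = G.vertexConnectivity ∧ G.IsCriticalSeparation S A B := by
  classical
  have hcard : ∀ v, ∀ N : Finset V, (∀ t, G.Adj v t → t ∈ N) →
      G.vertexConnectivity < N.card := by
    intro v N hN
    have h1 : (G.neighborFinset v).card ≤ N.card :=
      Finset.card_le_card (fun t ht => hN t (by simpa using ht))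
    have h2 := G.minDegree_le_degree v
    rw [← card_neighborFinset_eq_degree] at h2
    omega
  have hnbr : ∀ v, ∃ w, G.Adj v w := by
    intro v
    by_contra! h
    have := hcard v ∅ (fun t ht => absurd ht (h t))
    simp at this
  have hne : {n | ∃ S : Finset V, S.card = n ∧
      (G.IsVertexCutSet S ∨ ((S : Set V)ᶜ).Subsingleton)}.Nonempty :=
    ⟨_, Finset.univ, rfl, Or.inr (by simp)⟩
  obtain ⟨S, hS, hcut⟩ := Nat.sInf_mem hne
  change S.card = G.vertexConnectivity at hS
  have hcut : G.IsVertexCutSet S := by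
    -- The alternative of at most one remaining vertex would put a whole neighbourhood into `S`,
    -- against `κ < δ`.
    refine hcut.resolve_right fun hsub => ?_
    by_cases he : ∃ v, v ∉ S
    · obtain ⟨v, hv⟩ := he
      have := hcard v S (fun t ht => by
        by_contra htS
        exact ht.ne (hsub (by simpa using hv) (by simpa using htS)))
      omega
    · push Not at he
      have hG2 : 2 ≤ S.card := hS ▸ hG.2.1
      obtain ⟨v, hv⟩ := Finset.card_pos.1 (show 0 < S.card by omega)
      have := hcard v (S.erase v) (fun t ht => Finset.mem_erase.2 ⟨ht.ne', he t⟩)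
      rw [Finset.card_erase_of_mem hv] at this
      omega
  unfold IsVertexCutSet Preconnected at hcut
  push Not at hcut
  obtain ⟨⟨u, hu⟩, ⟨v, hv⟩, huv⟩ := hcut
  have hu : u ∉ S := by simpa using hu
  have hv : v ∉ S := by simpa using hv
  let P : V → Prop := fun t => ∃ ht : t ∉ S,
    (G.induce ((S : Set V)ᶜ)).Reachable ⟨u, hu⟩ ⟨t, ht⟩
  have hPu : P u := ⟨hu, Reachable.refl _⟩
  have hPv : ¬ P v := fun ⟨_, h⟩ => huv h
  have hPS : ∀ t, P t → t ∉ S := fun t ⟨h, _⟩ => h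
  have hPcl : ∀ a b, P a → b ∉ S → G.Adj a b → P b := by
    rintro a b ⟨ha, hr⟩ hb hab
    exact ⟨hb, hr.trans (Adj.reachable (by simpa using hab))⟩
  let A : Finset V := Finset.univ.filter P
  let B : Finset V := Finset.univ.filter fun t => t ∉ S ∧ ¬ P t
  have memA : ∀ t, t ∈ A ↔ P t := fun t => by simp [A]
  have memB : ∀ t, t ∈ B ↔ t ∉ S ∧ ¬ P t := fun t => by simp [B]
  have hPB : ∀ a b, P a → b ∈ B → ¬ G.Adj a b := fun a b ha hb hab =>
    ((memB b).1 hb).2 (hPcl a b ha ((memB b).1 hb).1 hab)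
  have hmin : ∀ x ∈ S, ¬ G.IsVertexCutSet (S.erase x) := by
    intro x hx hc
    have h1 := vertexConnectivity_le hc
    have h2 := Finset.card_erase_lt_of_mem hx
    omega
  have hA : ∀ x ∈ S, ∃ a ∈ A, G.Adj x a := by
    intro x hx
    by_contra! h
    refine hmin x hx (isVertexCutSet_of_closed (A := P) ?_ hPu (by simp [hu]) hPv (by simp [hv]))
    intro a b ha hb hab
    rw [Finset.mem_erase] at hb
    by_cases hbx : b = x
    · subst hbx
      exact absurd hab.symm (h a ((memA a).2 ha))
    · exact hPcl a b ha (fun h => hb ⟨hbx, h⟩) hab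
  have hB : ∀ x ∈ S, ∃ b ∈ B, G.Adj x b := by
    intro x hx
    by_contra! h
    refine hmin x hx (isVertexCutSet_of_closed (A := (· ∈ B)) ?_ ((memB v).2 ⟨hv, hPv⟩)
      (by simp [hv]) (fun h => ((memB u).1 h).2 hPu) (by simp [hu]))
    intro a b ha hb hab
    rw [Finset.mem_erase] at hb
    by_cases hbx : b = x
    · subst hbx
      exact absurd hab.symm (h a ha)
    · rw [memB]
      exact ⟨fun h => hb ⟨hbx, h⟩, fun hp => hPB b a hp ha hab.symm⟩
  have hcov : ∀ v, v ∈ S ∨ v ∈ A ∨ v ∈ B := by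
    intro v
    rw [memA, memB]
    tauto
  have hdom := hG.2.exists_dominatesAllBut hnbr
  have hSA : ∀ t ∈ S, t ∉ A := fun t ht h => hPS t ((memA t).1 h) ht
  have hSB : ∀ t ∈ S, t ∉ B := fun t ht h => ((memB t).1 h).1 ht
  have hAB : ∀ t ∈ A, t ∉ B := fun t ht h => ((memB t).1 h).2 ((memA t).1 ht)
  have hnadj : ∀ a ∈ A, ∀ b ∈ B, ¬ G.Adj a b := fun a ha b hb => hPB a b ((memA a).1 ha) hb
  have hAnbr : ∀ a ∈ A, ∀ t, G.Adj a t → t ∈ S ∨ t ∈ A := by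
    intro a ha t hat
    rcases hcov t with h | h | h
    · exact Or.inl h
    · exact Or.inr h
    · exact absurd hat (hnadj a ha t h)
  have hBnbr : ∀ b ∈ B, ∀ t, G.Adj b t → t ∈ S ∨ t ∈ B := by
    intro b hb t hbt
    rcases hcov t with h | h | h
    · exact Or.inl h
    · exact absurd hbt.symm (hnadj t h b hb)
    · exact Or.inr h
  have hother : ∀ X : Finset V, (∀ a ∈ X, ∀ t, G.Adj a t → t ∈ S ∨ t ∈ X) →
      ∀ a ∈ X, ∃ a' ∈ X, a' ≠ a := by
    intro X hX a ha
    by_contra! h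
    have := hcard a S (fun t hat => (hX a ha t hat).resolve_right
      fun ht => hat.ne (h t ht).symm)
    omega
  -- Otherwise the pair of `t` avoids `S`, hence lies on one side, and a vertex other than `t` on
  -- the other side stays undominated.
  have hmiss : ∀ t, ∃ x ∈ S, x ≠ t ∧ ¬ G.Adj x t := by
    intro t
    obtain ⟨x, y, hxy, hx, hy, hxt, hyt, hd⟩ := hdom t
    by_contra! hc
    have hxS : x ∉ S := fun h => hxt (hc x h hx)
    have hyS : y ∉ S := fun h => hyt (hc y h hy)
    have fA : ∃ a ∈ A, a ≠ t := by
      by_contra! h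
      obtain ⟨a, ha, hne⟩ := hother A hAnbr u ((memA u).2 hPu)
      exact hne ((h a ha).trans (h u ((memA u).2 hPu)).symm)
    have fB : ∃ a ∈ B, a ≠ t := by
      by_contra! h
      obtain ⟨a, ha, hne⟩ := hother B hBnbr v ((memB v).2 ⟨hv, hPv⟩)
      exact hne ((h a ha).trans (h v ((memB v).2 ⟨hv, hPv⟩)).symm)
    obtain ⟨a, ha, hat⟩ := fA
    obtain ⟨b, hb, hbt⟩ := fB
    have h1 := hd a hat
    have h2 := hd b hbt
    have := hcov x
    have := hcov y
    have hs : ∀ a b, G.Adj a b → G.Adj b a := fun _ _ h => h.symm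
    grind
  have hthree : ∀ X : Finset V, (∀ t ∈ S, t ∉ X) → (∀ a ∈ X, ∀ t, G.Adj a t → t ∈ S ∨ t ∈ X) →
      X.Nonempty → 3 ≤ X.card := by
    rintro X hdisj hX ⟨a, ha⟩
    obtain ⟨x, hx, hxa, hnx⟩ := hmiss a
    -- The neighbours of `a` avoid both `x` and `a`, so `|S| < (|S| - 1) + (|X| - 1)`.
    have := hcard a (S.erase x ∪ X.erase a) (fun t hat => by
      rw [Finset.mem_union, Finset.mem_erase, Finset.mem_erase]
      have := hX a ha t hat
      have h1 : t ≠ x := by rintro rfl; exact hnx hat.symm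
      have h2 := hat.ne'
      tauto)
    have h2 := Finset.card_union_le (S.erase x) (X.erase a)
    rw [Finset.card_erase_of_mem hx, Finset.card_erase_of_mem ha] at h2
    have h3 := Finset.card_pos.2 ⟨x, hx⟩
    omega
  exact ⟨S, A, B, hS, hcov, hSA, hSB, hAB, hnadj, hA, hB,
    hthree A hSA hAnbr ⟨u, (memA u).2 hPu⟩, hthree B hSB hBnbr ⟨v, (memB v).2 ⟨hv, hPv⟩⟩,
    hS ▸ hcard, hdom, fun u v huv h => hG.1.dominates_or_dominatesAllBut hnbr huv h⟩

namespace IsCriticalSeparation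
variable {G : SimpleGraph V} {S A B : Finset V}

theorem symm (h : G.IsCriticalSeparation S A B) : G.IsCriticalSeparation S B A where
  cover v := by have := h.cover v; tauto
  disj_left := h.disj_right
  disj_right := h.disj_left
  disj v hv hv' := h.disj v hv' hv
  not_adj a ha b hb hab := h.not_adj b hb a ha hab.symm
  exists_adj_left := h.exists_adj_right
  exists_adj_right := h.exists_adj_left
  card_left := h.card_right
  card_right := h.card_left
  card_lt := h.card_lt
  exists_dominatesAllBut := h.exists_dominatesAllBut
  trichotomy := h.trichotomy

theorem exists_ne_left (h : G.IsCriticalSeparation S A B) (x y : V) :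
    ∃ a ∈ A, a ≠ x ∧ a ≠ y := by
  classical
  by_contra! hc
  have : A ⊆ {x, y} := fun a ha => by
    have := hc a ha
    simp only [Finset.mem_insert, Finset.mem_singleton]
    tauto
  have h1 := (Finset.card_le_card this).trans Finset.card_le_two
  have := h.card_left
  omega

theorem exists_ne_right (h : G.IsCriticalSeparation S A B) (x y : V) :
    ∃ b ∈ B, b ≠ x ∧ b ≠ y := h.symm.exists_ne_left x y

/-- A dominating pair of `G - v` meets the cut. -/
theorem exists_mem_dominatesAllBut (h : G.IsCriticalSeparation S A B) (v : V) :
    ∃ x ∈ S, ∃ y, G.DominatesAllBut x y v := by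
  obtain ⟨x, y, hxy⟩ := h.exists_dominatesAllBut v
  by_contra! hc
  have hxS : x ∉ S := fun hx => hc x hx y hxy
  have hyS : y ∉ S := fun hy => hc y hy x hxy.symm
  obtain ⟨hadj, hx, hy, hxt, hyt, hd⟩ := hxy
  obtain ⟨a, ha, hav, -⟩ := h.exists_ne_left v v
  obtain ⟨b, hb, hbv, -⟩ := h.exists_ne_right v v
  have h1 := hd a hav
  have h2 := hd b hbv
  have := h.cover x
  have := h.cover y
  have hs : ∀ a b, G.Adj a b → G.Adj b a := fun _ _ h => h.symm
  have := h.not_adj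
  have := h.disj
  grind

/-- With `w` outside `S` the edge `uw` would lie on one side, and the other side has a vertex
besides `v`. -/
theorem mem_of_dominatesAllBut (h : G.IsCriticalSeparation S A B) {u w v : V}
    (hu : u ∉ S) (hw : G.DominatesAllBut u w v) : w ∈ S := by
  obtain ⟨hadj, hx, hy, hxt, hyt, hd⟩ := hw
  obtain ⟨a, ha, hav, -⟩ := h.exists_ne_left v v
  obtain ⟨b, hb, hbv, -⟩ := h.exists_ne_right v v
  have h1 := hd a hav
  have h2 := hd b hbv
  have := h.cover u
  have := h.cover w
  have hs : ∀ a b, G.Adj a b → G.Adj b a := fun _ _ h => h.symm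
  have := h.not_adj
  have := h.disj
  grind

theorem exists_adj_mem_left (h : G.IsCriticalSeparation S A B) {a : V} (ha : a ∈ A) :
    ∃ a' ∈ A, G.Adj a a' := by
  by_contra! hc
  refine absurd (h.card_lt a S fun t hat => ?_) (lt_irrefl _)
  rcases h.cover t with ht | ht | ht
  · exact ht
  · exact absurd hat (hc t ht)
  · exact absurd hat (h.not_adj a ha t ht)

theorem exists_adj_mem_right (h : G.IsCriticalSeparation S A B) {b : V} (hb : b ∈ B) :
    ∃ b' ∈ B, G.Adj b b' := h.symm.exists_adj_mem_left hb

end IsCriticalSeparation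

/-! ### Counting witnesses -/

/-- If a relation assigns to each element of `T` some element of `N`, no element of `N` being
assigned twice, and `N` is at most as large as `T`, then the assignment is a bijection. -/
theorem exists_bijective_choice {T N : Finset V} {Q : V → V → Prop}
    (hT : ∀ p ∈ T, ∃ w ∈ N, Q w p)
    (hQ : ∀ w p p', p ∈ T → p' ∈ T → Q w p → Q w p' → p = p') (hcard : N.card ≤ T.card) :
    ∃ b : V → V, (∀ p ∈ T, b p ∈ N ∧ Q (b p) p) ∧ ∀ w ∈ N, ∃ p ∈ T, w = b p := by
  classical
  choose! b hb using hT
  have hinj : Set.InjOn b T := fun p hp p' hp' he =>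
    hQ (b p) p p' hp hp' (hb p hp).2 (he ▸ (hb p' hp').2)
  have hsub : T.image b ⊆ N := fun w hw => by
    obtain ⟨p, hp, rfl⟩ := Finset.mem_image.1 hw
    exact (hb p hp).1
  have heq : T.image b = N :=
    Finset.eq_of_subset_of_card_le hsub (by rwa [Finset.card_image_of_injOn hinj])
  refine ⟨b, hb, fun w hw => ?_⟩
  rw [← heq] at hw
  obtain ⟨p, hp, he⟩ := Finset.mem_image.1 hw
  exact ⟨p, hp, he.symm⟩

/-- The variant of `exists_bijective_choice` in which one element of `N` may be missed. -/
theorem exists_almost_bijective_choice {T N : Finset V} {Q : V → V → Prop}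
    (hT : ∀ p ∈ T, ∃ w ∈ N, Q w p)
    (hQ : ∀ w p p', p ∈ T → p' ∈ T → Q w p → Q w p' → p = p') (hcard : N.card = T.card + 1) :
    ∃ b : V → V, ∃ z ∈ N, (∀ p ∈ T, b p ∈ N ∧ Q (b p) p ∧ b p ≠ z) ∧
      ∀ w ∈ N, w = z ∨ ∃ p ∈ T, w = b p := by
  classical
  choose! b hb using hT
  have hinj : Set.InjOn b T := fun p hp p' hp' he =>
    hQ (b p) p p' hp hp' (hb p hp).2 (he ▸ (hb p' hp').2)
  have hsub : T.image b ⊆ N := fun w hw => by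
    obtain ⟨p, hp, rfl⟩ := Finset.mem_image.1 hw
    exact (hb p hp).1
  have hc : (N \ T.image b).card = 1 := by
    rw [Finset.card_sdiff_of_subset hsub, Finset.card_image_of_injOn hinj]
    omega
  obtain ⟨z, hz⟩ := Finset.card_eq_one.1 hc
  have hz' : ∀ w, w ∈ N ∧ w ∉ T.image b ↔ w = z := fun w => by
    rw [← Finset.mem_sdiff, hz, Finset.mem_singleton]
  refine ⟨b, z, ((hz' z).2 rfl).1, fun p hp => ⟨(hb p hp).1, (hb p hp).2, fun he => ?_⟩,
    fun w hw => ?_⟩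
  · exact ((hz' z).2 rfl).2 (Finset.mem_image.2 ⟨p, hp, he⟩)
  · by_cases h : w ∈ T.image b
    · obtain ⟨p, hp, he⟩ := Finset.mem_image.1 h
      exact Or.inr ⟨p, hp, he.symm⟩
    · exact Or.inl ((hz' w).1 ⟨hw, h⟩)


/-! ### An independent set as large as the cut -/

/-- Among the vertices of `I`, the vertex `w` misses exactly `p`. -/
def MissesOnly (G : SimpleGraph V) (I : Finset V) (w p : V) : Prop :=
  ¬ G.Adj w p ∧ ∀ q ∈ I, q ≠ p → G.Adj w q

theorem MissesOnly.eq_of_not_adj {G : SimpleGraph V} {I : Finset V} {w p q : V}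
    (h : G.MissesOnly I w p) (hq : q ∈ I) (hwq : ¬ G.Adj w q) : q = p := by
  by_contra hne
  exact hwq (h.2 q hq hne)

/-- A critical separation with an independent set of the same size as the cut. -/
structure IsCriticalConfiguration (G : SimpleGraph V) (S A B I : Finset V) : Prop extends
    G.IsCriticalSeparation S A B where
  indep : ∀ p ∈ I, ∀ q ∈ I, ¬ G.Adj p q
  card_eq : I.card = S.card
  three_le : 3 ≤ I.card

namespace IsCriticalConfiguration
variable {G : SimpleGraph V} {S A B I : Finset V}

theorem swap (h : G.IsCriticalConfiguration S A B I) : G.IsCriticalConfiguration S B A I :=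
  ⟨h.toIsCriticalSeparation.symm, h.indep, h.card_eq, h.three_le⟩

theorem card_sdiff_eq [DecidableEq V] (h : G.IsCriticalConfiguration S A B I) :
    (S \ I).card = (I \ S).card := by
  have h1 := Finset.card_sdiff_add_card_inter S I
  have h2 := Finset.card_sdiff_add_card_inter I S
  rw [Finset.inter_comm] at h2
  have := h.card_eq
  omega

theorem missesOnly (h : G.IsCriticalConfiguration S A B I) {p w q : V} (hp : p ∈ I)
    (hw : G.DominatesAllBut p w q) : G.MissesOnly I w q := by
  refine ⟨hw.2.2.2.2.1, fun t ht htq => ?_⟩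
  rcases hw.2.2.2.2.2 t htq with rfl | rfl | h1 | h1
  · exact hw.1.symm
  · exact absurd hw.1 (h.indep p hp _ ht)
  · exact absurd h1 (h.indep p hp _ ht)
  · exact h1

theorem notMem_of_dominatesAllBut (h : G.IsCriticalConfiguration S A B I) {p w q : V} (hp : p ∈ I)
    (hw : G.DominatesAllBut p w q) : w ∉ I :=
  fun hwI => h.indep p hp w hwI hw.1

theorem exists_mem_ne (h : G.IsCriticalConfiguration S A B I) (p q : V) :
    ∃ r ∈ I, r ≠ p ∧ r ≠ q := by
  classical
  by_contra! hc
  have : I ⊆ {p, q} := fun a ha => by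
    have := hc a ha
    simp only [Finset.mem_insert, Finset.mem_singleton]
    tauto
  have h1 := (Finset.card_le_card this).trans Finset.card_le_two
  have := h.three_le
  omega

/-- A third member of `I`, which exists by `three_le`, is adjacent to neither `p` nor `q`. -/
theorem exists_dominatesAllBut_of_ne (h : G.IsCriticalConfiguration S A B I) {p q : V}
    (hp : p ∈ I) (hq : q ∈ I) (hpq : p ≠ q) :
    (∃ w, G.DominatesAllBut p w q) ∨ ∃ w, G.DominatesAllBut q w p := by
  refine (h.trichotomy p q hpq (h.indep p hp q hq)).resolve_left fun hd => ?_
  obtain ⟨r, hr, hrp, hrq⟩ := h.exists_mem_ne p q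
  have := hd r
  have := h.indep p hp r hr
  have := h.indep q hq r hr
  tauto

/-- Nonadjacent vertices `u` and `p ∈ I` on different sides, when `p` is not alone on its side. -/
theorem cross (h : G.IsCriticalConfiguration S A B I) {p p' u : V} (hp : p ∈ I) (hpA : p ∈ A)
    (hp' : p' ∈ I) (hpA' : p' ∈ A) (hne : p' ≠ p) (hu : u ∉ I) (huB : u ∈ B) :
    (∃ w ∈ S, w ∉ I ∧ (∀ q ∈ I, G.Adj w q) ∧ ¬ G.Adj w u ∧ ∀ t ∈ B, t ≠ u → G.Adj w t) ∨
    ∃ w ∈ S, w ∉ I ∧ G.Adj w u ∧ ¬ G.Adj w p ∧ (∀ t ∈ A, t ≠ p → G.Adj w t) := by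
  have hs : ∀ a b, G.Adj a b → G.Adj b a := fun _ _ h => h.symm
  have hnot := h.not_adj
  have hdisj := h.disj
  have hdl := h.disj_left
  have hdr := h.disj_right
  have hind := h.indep
  have hpu : p ≠ u := by rintro rfl; exact hu hp
  -- `p'` excludes the first case: it is independent of `p` and on the other side from `u`. In the
  -- last case it must be adjacent to `w`, which forces `w ∉ I`.
  rcases h.trichotomy p u hpu (h.not_adj p hpA u huB) with hd | ⟨w, hw⟩ | ⟨w, hw⟩
  · have := hd p'
    grind
  · have hwS := h.mem_of_dominatesAllBut (fun hS => hdl p hS hpA) hw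
    obtain ⟨h1, h2, h3, h4, h5, h6⟩ := hw
    refine Or.inl ⟨w, hwS, ?_, ?_, h5, ?_⟩
    · grind
    · intro q hq
      have := h6 q (by rintro rfl; exact hu hq)
      grind
    · intro t ht
      have := h6 t
      grind
  · have hwS := h.mem_of_dominatesAllBut (fun hS => hdr u hS huB) hw
    obtain ⟨h1, h2, h3, h4, h5, h6⟩ := hw
    refine Or.inr ⟨w, hwS, ?_, h1.symm, h5, ?_⟩
    · have := h6 p'
      grind
    · intro t ht
      have := h6 t
      grind

theorem exists_notMem_left (h : G.IsCriticalConfiguration S A B I) : ∃ u ∈ A, u ∉ I := by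
  by_contra! hc
  obtain ⟨a, ha⟩ := Finset.card_pos.1 (show 0 < A.card by have := h.card_left; omega)
  obtain ⟨a', ha', hadj⟩ := h.exists_adj_mem_left ha
  exact h.indep a (hc a ha) a' (hc a' ha') hadj

theorem exists_notMem_right (h : G.IsCriticalConfiguration S A B I) : ∃ u ∈ B, u ∉ I :=
  h.swap.exists_notMem_left

/-! ### Every vertex of `I \ S` has a witness in `S \ I` -/

section bijective
variable {b : V → V}

/-- Each vertex of `S \ I` misses some member of `I`, so the first alternative of `cross` fails; in
the second, `w` misses `p` and hence equals `b p`. -/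
theorem cross_bijective (h : G.IsCriticalConfiguration S A B I)
    (hb : ∀ p ∈ I, p ∉ S → b p ∈ S ∧ b p ∉ I ∧ G.MissesOnly I (b p) p)
    (hsurj : ∀ w ∈ S, w ∉ I → ∃ p ∈ I, p ∉ S ∧ w = b p) {p p' u : V}
    (hp : p ∈ I) (hpA : p ∈ A) (hp' : p' ∈ I) (hpA' : p' ∈ A) (hne : p' ≠ p) (hu : u ∉ I)
    (huB : u ∈ B) : G.Adj (b p) u ∧ ∀ t ∈ A, t ≠ p → G.Adj (b p) t := by
  rcases h.cross hp hpA hp' hpA' hne hu huB with ⟨w, hwS, hwI, hall, -⟩ | ⟨w, hwS, hwI, h1, h2, h3⟩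
  · obtain ⟨q, hq, hqS, rfl⟩ := hsurj w hwS hwI
    exact absurd (hall q hq) (hb q hq hqS).2.2.1
  · obtain ⟨q, hq, hqS, rfl⟩ := hsurj w hwS hwI
    have := (hb q hq hqS).2.2.eq_of_not_adj hp h2
    subst this
    exact ⟨h1, h3⟩

/-- All of `S \ I` is adjacent to `u`, so the pair of `u` has a vertex in `I ∩ S`, and its partner
lies outside `S`. That partner would have to dominate members of `I` on both sides. -/
theorem false_of_bijective_of_two_two (h : G.IsCriticalConfiguration S A B I)
    (hb : ∀ p ∈ I, p ∉ S → b p ∈ S ∧ b p ∉ I ∧ G.MissesOnly I (b p) p)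
    (hsurj : ∀ w ∈ S, w ∉ I → ∃ p ∈ I, p ∉ S ∧ w = b p)
    (hA : ∀ p, ∃ p' ∈ I, p' ∈ A ∧ p' ≠ p) (hB : ∀ p, ∃ p' ∈ I, p' ∈ B ∧ p' ≠ p) : False := by
  have hs : ∀ a b, G.Adj a b → G.Adj b a := fun _ _ h => h.symm
  have hdl := h.disj_left
  have hdr := h.disj_right
  have hind := h.indep
  have hnot := h.not_adj
  obtain ⟨u, huA, huI⟩ := h.exists_notMem_left
  obtain ⟨v, hvB, hvI⟩ := h.exists_notMem_right
  have key : ∀ w ∈ S, w ∉ I → G.Adj w u := by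
    intro w hw hwI
    obtain ⟨p, hp, hpS, rfl⟩ := hsurj w hw hwI
    rcases (h.cover p).resolve_left hpS with hpA | hpB
    · obtain ⟨p', hp', hpA', hne⟩ := hA p
      exact (h.cross_bijective hb hsurj hp hpA hp' hpA' hne hvI hvB).2 u huA
        (by rintro rfl; exact huI hp)
    · obtain ⟨p', hp', hpB', hne⟩ := hB p
      exact (h.swap.cross_bijective hb hsurj hp hpB hp' hpB' hne huI huA).1
  obtain ⟨x, hxS, y, hxy⟩ := h.exists_mem_dominatesAllBut u
  obtain ⟨pA, hpA⟩ := hA u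
  obtain ⟨pB, hpB⟩ := hB u
  have h1 := hxy.2.2.2.2.2 pA
  have h2 := hxy.2.2.2.2.2 pB
  obtain ⟨hadj, hx, hy, hxu, hyu, -⟩ := hxy
  have h3 := h.cover y
  grind

/-- For `v ≠ a` in `B`, only `b a` in `S \ I` can miss `v`. If it did not, the pair of `v` would
consist of a vertex of `I ∩ S` and one outside `S`, unable to dominate `I` on both sides. So `b a`
has no neighbour in `B`, against the minimality of the cut. -/
theorem false_of_bijective_of_two_one (h : G.IsCriticalConfiguration S A B I)
    (hb : ∀ p ∈ I, p ∉ S → b p ∈ S ∧ b p ∉ I ∧ G.MissesOnly I (b p) p)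
    (hsurj : ∀ w ∈ S, w ∉ I → ∃ p ∈ I, p ∉ S ∧ w = b p)
    (hA : ∀ p, ∃ p' ∈ I, p' ∈ A ∧ p' ≠ p) {a : V} (ha : a ∈ I) (haB : a ∈ B)
    (hB : ∀ p ∈ I, p ∈ B → p = a) : False := by
  have hs : ∀ a b, G.Adj a b → G.Adj b a := fun _ _ h => h.symm
  have hdl := h.disj_left
  have hdr := h.disj_right
  have hind := h.indep
  have hnot := h.not_adj
  have haS : a ∉ S := fun hS => hdr a hS haB
  have key : ∀ v ∈ B, ¬ G.Adj (b a) v := by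
    intro v hv
    by_cases hva : v = a
    · exact hva ▸ (hb a ha haS).2.2.1
    have hvI : v ∉ I := fun hI => hva (hB v hI hv)
    have hadj : ∀ p ∈ I, p ∈ A → G.Adj (b p) v := by
      intro p hp hpA
      obtain ⟨p', hp', hpA', hne⟩ := hA p
      exact (h.cross_bijective hb hsurj hp hpA hp' hpA' hne hvI hv).1
    have hS' : ∀ w ∈ S, w ∉ I → ¬ G.Adj w v → w = b a := by
      intro w hw hwI hwv
      obtain ⟨p, hp, hpS, rfl⟩ := hsurj w hw hwI
      rcases (h.cover p).resolve_left hpS with hpA | hpB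
      · exact absurd (hadj p hp hpA) hwv
      · rw [hB p hp hpB]
    obtain ⟨x, hxS, y, hxy⟩ := h.exists_mem_dominatesAllBut v
    obtain ⟨pA, hpA⟩ := hA v
    have h1 := hxy.2.2.2.2.2 pA
    have h2 := hxy.2.2.2.2.2 a
    obtain ⟨hadj, hx, hy, hxu, hyu, -⟩ := hxy
    have h3 := h.cover y
    grind
  obtain ⟨v, hv, hadj⟩ := h.exists_adj_right (b a) (hb a ha haS).1
  exact key v hv hadj

end bijective

/-- The bijective case when `I` has exactly one vertex on each side. -/
theorem false_of_bijective_of_one_one (h : G.IsCriticalConfiguration S A B I) {a₁ a₂ x y : V}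
    (h₁ : a₁ ∈ I) (h₁A : a₁ ∈ A) (h₂ : a₂ ∈ I) (h₂B : a₂ ∈ B) (hB : ∀ p ∈ I, p ∈ B → p = a₂)
    (hyS : y ∈ S) (hyI : y ∉ I) (hx : G.DominatesAllBut a₁ x a₂) (hy : G.MissesOnly I y a₁)
    (hsurj : ∀ w ∈ S, w ∉ I → w = x ∨ w = y) : False := by
  have hs : ∀ a b, G.Adj a b → G.Adj b a := fun _ _ h => h.symm
  have hdl := h.disj_left
  have hdr := h.disj_right
  have hdisj := h.disj
  have hind := h.indep
  have hnot := h.not_adj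
  have hxm := h.missesOnly h₁ hx
  have hxB : ∀ v ∈ B, v ≠ a₂ → G.Adj x v := by
    intro v hv hva
    have := hx.2.2.2.2.2 v hva
    have hxS := h.mem_of_dominatesAllBut (fun hS => hdl a₁ hS h₁A) hx
    grind
  -- Two such vertices `v` contradict each other, and `B` has at least three vertices. The pair of
  -- `v` turns out to be `y` and a vertex of `A`, so `y` alone dominates the rest of `B`.
  have key : ∀ v ∈ B, v ≠ a₂ → ¬ G.Adj y v ∧ ∀ t ∈ B, t ≠ v → G.Adj y t := by
    intro v hv hva
    have hvI : v ∉ I := fun hI => hva (hB v hI hv)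
    have hav : a₁ ≠ v := fun he => hvI (he ▸ h₁)
    have hxv := hxB v hv hva
    have hJ : G.Adj y v ∨ ∀ q ∈ I, q ∈ S → G.Adj v q := by
      rcases h.trichotomy a₁ v hav (hnot a₁ h₁A v hv) with hd | ⟨w, hw⟩ | ⟨w, hw⟩
      · have := hd y
        grind
      · have hwS := h.mem_of_dominatesAllBut (fun hS => hdl a₁ hS h₁A) hw
        have hwI := h.notMem_of_dominatesAllBut h₁ hw
        have := hw.1
        have := hw.2.2.2.2.1
        have := hsurj w hwS hwI
        have := hy.1
        grind
      · have hwS := h.mem_of_dominatesAllBut (fun hS => hdr v hS hv) hw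
        by_cases hwI : w ∈ I
        · right
          intro q hq hqS
          have := hw.2.2.2.2.2 q (by rintro rfl; exact hdl q hqS h₁A)
          have := hw.1
          grind
        · have := hw.1
          have := hw.2.2.2.2.1
          have := hsurj w hwS hwI
          have := hxm.2 a₁ h₁
          grind
    obtain ⟨s, hsS, t, hst⟩ := h.exists_mem_dominatesAllBut v
    have h1 := hst.2.2.2.2.2 a₁ hav
    have h2 := hst.2.2.2.2.2 a₂ hva.symm
    have h3 := hst.2.2.2.2.2
    obtain ⟨hadj, hsv, htv, hsv', htv', -⟩ := hst
    have h4 := h.cover t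
    have hy1 := hy.1
    have hyv : ¬ G.Adj y v := by grind
    have hsy : s = y := by grind
    have htA : t ∈ A := by grind
    refine ⟨hyv, fun t' ht' hne => ?_⟩
    have := h3 t' hne
    grind
  obtain ⟨v, hv, hva, -⟩ := h.exists_ne_right a₂ a₂
  obtain ⟨v', hv', hva', hne⟩ := h.exists_ne_right a₂ v
  exact (key v' hv' hva').1 ((key v hv hva).2 v' hv' hne)


/-! ### Some vertex of `I \ S` has no witness in `S \ I` -/

/-- If `z` and a vertex outside the cut dominate all but `v` for every `v ∈ B \ {a}`, then `a` has
no neighbour in `B`. -/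
theorem false_of_forall_dominatesAllBut (h : G.IsCriticalConfiguration S A B I) {a z : V}
    (haB : a ∈ B) (hz : ∀ v ∈ B, v ≠ a → ∃ y, y ∉ S ∧ G.DominatesAllBut z y v) : False := by
  obtain ⟨v, hv, hav⟩ := h.exists_adj_mem_right haB
  have hva : v ≠ a := hav.ne'
  obtain ⟨y, hyS, hy⟩ := hz v hv hva
  obtain ⟨v', hv', hva', hvv⟩ := h.exists_ne_right a v
  obtain ⟨y', -, hy'⟩ := hz v' hv' hva'
  have h1 := hy.2.2.2.2.2 v' hvv
  -- From `A`, `y` would leave `v'` to `z`, which misses it. Once `y ∈ B`, either `y = a` is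
  -- adjacent to `v`, or the hypothesis at `y` denies the edge `zy`.
  have hyB : y ∈ B := by
    refine ((h.cover y).resolve_left hyS).resolve_left fun hyA => ?_
    have := hy'.2.2.2.1
    have := h.disj y
    have := h.not_adj y hyA v' hv'
    have := hy'.2.1
    grind
  by_cases hya : y = a
  · subst hya
    exact hy.2.2.2.2.1 hav
  · obtain ⟨y'', -, hy''⟩ := hz y hyB hya
    exact hy''.2.2.2.1 hy.1

/-- `q` has no witness, so it beats `a`; as `a` has none either, this happens through some `w ∉ S`.
Adjacency to `p` puts `w` in `A`, and `q` has to dominate `B` without its help. -/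
theorem adj_right_of_not_missesOnly (h : G.IsCriticalConfiguration S A B I) {a p q : V}
    (ha : a ∈ I) (haB : a ∈ B) (hp : p ∈ I) (hpA : p ∈ A)
    (hag : ¬ ∃ w ∈ S, w ∉ I ∧ G.MissesOnly I w a) (hq : q ∈ I) (hqS : q ∈ S)
    (hqg : ¬ ∃ w ∈ S, w ∉ I ∧ G.MissesOnly I w q) : ∀ t ∈ B, t ≠ a → G.Adj q t := by
  have haS : a ∉ S := fun hS => h.disj_right a hS haB
  have hqa : q ≠ a := by rintro rfl; exact haS hqS
  rcases h.exists_dominatesAllBut_of_ne hq ha hqa with ⟨w, hw⟩ | ⟨w, hw⟩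
  · have hwI := h.notMem_of_dominatesAllBut hq hw
    have hwS : w ∉ S := fun hwS => hag ⟨w, hwS, hwI, h.missesOnly hq hw⟩
    have hpa : p ≠ a := by rintro rfl; exact h.disj p hpA haB
    have hwp := (h.missesOnly hq hw).2 p hp hpa
    have hwA : w ∈ A := by
      rcases (h.cover w).resolve_left hwS with hh | hh
      · exact hh
      · exact absurd hwp.symm (h.not_adj p hpA w hh)
    intro t ht hta
    have h1 := hw.2.2.2.2.2 t hta
    have h2 := h.not_adj w hwA t ht
    have h3 := h.disj w hwA
    have h4 := h.disj_right q hqS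
    rcases h1 with rfl | rfl | h1 | h1
    · exact absurd ht h4
    · exact absurd ht h3
    · exact h1
    · exact absurd h1 h2
  · exact absurd ⟨w, h.mem_of_dominatesAllBut haS hw, h.notMem_of_dominatesAllBut ha hw,
      h.missesOnly ha hw⟩ hqg

/-- A vertex of `I` outside the cut which no cut vertex misses alone beats the rest of `I`. -/
theorem exists_dominatesAllBut_of_not_missesOnly (h : G.IsCriticalConfiguration S A B I) {a p : V}
    (ha : a ∈ I) (haS : a ∉ S) (hag : ¬ ∃ w ∈ S, w ∉ I ∧ G.MissesOnly I w a) (hp : p ∈ I)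
    (hpa : p ≠ a) (hpS : p ∉ S) : ∃ w ∈ S, w ∉ I ∧ G.DominatesAllBut a w p := by
  rcases h.exists_dominatesAllBut_of_ne hp ha hpa with ⟨w, hw⟩ | ⟨w, hw⟩
  · exact absurd ⟨w, h.mem_of_dominatesAllBut hpS hw, h.notMem_of_dominatesAllBut hp hw,
      h.missesOnly hp hw⟩ hag
  · exact ⟨w, h.mem_of_dominatesAllBut haS hw, h.notMem_of_dominatesAllBut ha hw, hw⟩

/-- `a` beats all other members of `I`, through all of `S` except one vertex `z`. The pairs of the
vertices of `B \ I` then all use `z` with a partner in `A`, which leaves only one vertex in `B \ I`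
and too few neighbours for `p`. -/
theorem false_of_disjoint (h : G.IsCriticalConfiguration S A B I) (hIS : ∀ p ∈ I, p ∉ S)
    {a p : V} (ha : a ∈ I) (haA : a ∈ A) (hp : p ∈ I) (hpB : p ∈ B)
    (hag : ¬ ∃ w ∈ S, w ∉ I ∧ G.MissesOnly I w a) : False := by
  classical
  have hs : ∀ a b, G.Adj a b → G.Adj b a := fun _ _ h => h.symm
  have hdl := h.disj_left
  have hdr := h.disj_right
  have hnot := h.not_adj
  obtain ⟨b, z, hzS, hb, hsurj⟩ := exists_almost_bijective_choice (T := I.erase a) (N := S)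
    (Q := fun w p => G.DominatesAllBut a w p)
    (fun p hp => by
      obtain ⟨hpa, hp⟩ := Finset.mem_erase.1 hp
      obtain ⟨w, hw, -, hd⟩ :=
        h.exists_dominatesAllBut_of_not_missesOnly ha (hIS a ha) hag hp hpa (hIS p hp)
      exact ⟨w, hw, hd⟩)
    (fun w p p' hp _ hw hw' => (h.missesOnly ha hw').eq_of_not_adj (Finset.mem_of_mem_erase hp)
      hw.2.2.2.2.1)
    (by
      rw [Finset.card_erase_of_mem ha]
      have := h.card_eq
      have := h.three_le
      omega)
  simp only [Finset.mem_erase] at hb hsurj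
  have hza : ¬ G.Adj z a := by
    obtain ⟨x, hx, y, hxy⟩ := h.exists_mem_dominatesAllBut a
    rcases hsurj x hx with rfl | ⟨p, hp, rfl⟩
    · exact hxy.2.2.2.1
    · exact absurd (hb p hp).2.1.1.symm hxy.2.2.2.1
  have key : ∀ u ∈ B, u ∉ I → ¬ G.Adj z u ∧ ∀ t ∈ B, t ≠ u → G.Adj z t := by
    intro u hu huI
    have hbu : ∀ p, p ≠ a ∧ p ∈ I → G.Adj (b p) u := by
      intro p hp
      obtain ⟨hbS, hd, -⟩ := hb p hp
      have := hd.2.2.2.2.2 u (by rintro rfl; exact huI hp.2)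
      grind
    have hzu : ∀ x ∈ S, ¬ G.Adj x u → x = z := by
      intro x hx hxu
      rcases hsurj x hx with rfl | ⟨p, hp, rfl⟩
      · rfl
      · exact absurd (hbu p hp) hxu
    obtain ⟨x, hx, y, hxy⟩ := h.exists_mem_dominatesAllBut u
    obtain rfl := hzu x hx hxy.2.2.2.1
    have hyS : y ∉ S := fun hyS => hxy.1.ne (hzu y hyS hxy.2.2.2.2.1).symm
    have h1 := hxy.2.2.2.2.2 a (by rintro rfl; exact huI ha)
    have hyA : y ∈ A := by
      have := h.cover y
      grind
    refine ⟨hxy.2.2.2.1, fun t ht htu => ?_⟩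
    have := hxy.2.2.2.2.2 t htu
    have := h.disj y
    grind
  obtain ⟨u, hu, huI⟩ := h.exists_notMem_right
  have hpa : p ≠ a ∧ p ∈ I := ⟨by rintro rfl; exact h.disj p haA hpB, hp⟩
  have := h.card_lt p (insert u (S.erase (b p))) (fun t ht => by
    rw [Finset.mem_insert, Finset.mem_erase]
    rcases h.cover t with htS | htA | htB
    · refine Or.inr ⟨?_, htS⟩
      rintro rfl
      exact (hb p hpa).2.1.2.2.2.2.1 ht.symm
    · exact absurd ht.symm (hnot t htA p hpB)
    · left
      by_contra htu
      have htI : t ∉ I := fun htI => h.indep p hp t htI ht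
      exact (key t htB htI).1 ((key u hu huI).2 t htB htu))
  have h2 := Finset.card_insert_le u (S.erase (b p))
  rw [Finset.card_erase_of_mem (hb p hpa).1] at h2
  have := Finset.card_pos.2 ⟨z, hzS⟩
  omega

/-- `a` beats even the members of `I ∩ S`: a `w` through which it lost would lie outside `S` and be
adjacent to both `p₁` and `p₂`. Since `q ∈ S`, these witnesses exhaust `S \ I`, so only vertices of
`I` can represent the cut in the pair of `a`. -/
theorem false_of_both_sides (h : G.IsCriticalConfiguration S A B I) {a p₁ p₂ q : V}
    (ha : a ∈ I) (haS : a ∉ S) (hag : ¬ ∃ w ∈ S, w ∉ I ∧ G.MissesOnly I w a)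
    (h₁ : p₁ ∈ I) (h₁A : p₁ ∈ A) (h₁a : p₁ ≠ a) (h₂ : p₂ ∈ I) (h₂B : p₂ ∈ B) (h₂a : p₂ ≠ a)
    (hq : q ∈ I) (hqS : q ∈ S) : False := by
  classical
  have hs : ∀ a b, G.Adj a b → G.Adj b a := fun _ _ h => h.symm
  have hnot := h.not_adj
  have hind := h.indep
  obtain ⟨b, hb, hsurj⟩ := exists_bijective_choice (T := I.erase a) (N := S \ I)
    (Q := fun w p => G.DominatesAllBut a w p)
    (fun p hp => by
      obtain ⟨hpa, hp⟩ := Finset.mem_erase.1 hp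
      rcases h.exists_dominatesAllBut_of_ne hp ha hpa with ⟨w, hw⟩ | ⟨w, hw⟩
      · exfalso
        have hwI := h.notMem_of_dominatesAllBut hp hw
        have hm := h.missesOnly hp hw
        have hwS : w ∉ S := fun hwS => hag ⟨w, hwS, hwI, hm⟩
        have e1 := hm.2 p₁ h₁ h₁a
        have e2 := hm.2 p₂ h₂ h₂a
        rcases (h.cover w).resolve_left hwS with hw' | hw'
        · exact hnot w hw' p₂ h₂B e2
        · exact hnot p₁ h₁A w hw' e1.symm
      · exact ⟨w, Finset.mem_sdiff.2 ⟨h.mem_of_dominatesAllBut haS hw,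
          h.notMem_of_dominatesAllBut ha hw⟩, hw⟩)
    (fun w p p' hp _ hw hw' => (h.missesOnly ha hw').eq_of_not_adj (Finset.mem_of_mem_erase hp)
      hw.2.2.2.2.1)
    (by
      rw [h.card_sdiff_eq]
      have hsub : I \ S ⊆ I.erase q := fun p hp => by
        obtain ⟨hp, hpS⟩ := Finset.mem_sdiff.1 hp
        exact Finset.mem_erase.2 ⟨by rintro rfl; exact hpS hqS, hp⟩
      have := Finset.card_le_card hsub
      rwa [Finset.card_erase_of_mem hq, ← Finset.card_erase_of_mem ha] at this)
  simp only [Finset.mem_sdiff, Finset.mem_erase] at hb hsurj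
  obtain ⟨x, hx, y, hxy⟩ := h.exists_mem_dominatesAllBut a
  have hSI : ∀ w ∈ S, ¬ G.Adj w a → w ∈ I := by
    intro w hw hwa
    by_contra hwI
    obtain ⟨p, hp, rfl⟩ := hsurj w ⟨hw, hwI⟩
    exact hwa (hb p hp).2.1.symm
  have hxI := hSI x hx hxy.2.2.2.1
  have hyS : y ∉ S := fun hyS => hind x hxI y (hSI y hyS hxy.2.2.2.2.1) hxy.1
  have e1 := hxy.2.2.2.2.2 p₁ h₁a
  have e2 := hxy.2.2.2.2.2 p₂ h₂a
  have := hxy.1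
  have := h.cover y
  have := h.disj_left
  have := h.disj_right
  grind

section alone
variable {a : V}

/-- A vertex `v ≠ a` of `B` can be missed only by `b q₀` and `q₀` in `S`. The choice of `q₀` in its
pair would leave `p₁` and `a`, on opposite sides, to one partner outside `S`; so the pair uses `b
q₀`. -/
theorem false_of_alone_of_missesOnly (h : G.IsCriticalConfiguration S A B I)
    (ha : a ∈ I) (haB : a ∈ B) (hB : ∀ p ∈ I, p ∈ B → p = a)
    (hA : ∀ p, ∃ p' ∈ I, p' ∈ A ∧ p' ≠ p) {q₀ : V} (hq₀ : q₀ ∈ I) (hq₀S : q₀ ∈ S) {b : V → V}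
    (hb : ∀ p ∈ I, p ∈ A ∨ p = q₀ → b p ∈ S ∧ b p ∉ I ∧ G.MissesOnly I (b p) p)
    (hsurj : ∀ w ∈ S, w ∉ I → ∃ p ∈ I, (p ∈ A ∨ p = q₀) ∧ w = b p) : False := by
  have hs : ∀ a b, G.Adj a b → G.Adj b a := fun _ _ h => h.symm
  have hdl := h.disj_left
  have hdr := h.disj_right
  have hnot := h.not_adj
  have hind := h.indep
  have haS : a ∉ S := fun hS => hdr a hS haB
  have haA : a ∉ A := fun hA => h.disj a hA haB
  have hgood : ∀ p ∈ I, (∃ w ∈ S, w ∉ I ∧ G.MissesOnly I w p) → p ∈ A ∨ p = q₀ := by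
    rintro p hp ⟨w, hw, hwI, hm⟩
    obtain ⟨p', hp', hp'', rfl⟩ := hsurj w hw hwI
    have := hm.eq_of_not_adj hp' (hb p' hp' hp'').2.2.1
    exact this ▸ hp''
  have hag : ¬ ∃ w ∈ S, w ∉ I ∧ G.MissesOnly I w a := fun hg => by
    have := hgood a ha hg
    grind
  obtain ⟨p₁, h₁, h₁A, -⟩ := hA a
  have hq : ∀ q ∈ I, q ∈ S → q ≠ q₀ → ∀ t ∈ B, t ≠ a → G.Adj q t := by
    intro q hq hqS hne
    refine h.adj_right_of_not_missesOnly ha haB h₁ h₁A hag hq hqS fun hg => ?_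
    have := hgood q hq hg
    grind
  have hbq := hb q₀ hq₀ (Or.inr rfl)
  refine h.false_of_forall_dominatesAllBut haB (z := b q₀) fun v hv hva => ?_
  have hvI : v ∉ I := fun hI => hva (hB v hI hv)
  have hbv : ∀ p ∈ I, p ∈ A → G.Adj (b p) v := by
    intro p hp hpA
    obtain ⟨p', hp', hpA', hne⟩ := hA p
    rcases h.cross hp hpA hp' hpA' hne hvI hv with ⟨w, hw, hwI, hall, -⟩ | ⟨w, hw, hwI, h1, h2, -⟩
    · obtain ⟨r, hr, hr', rfl⟩ := hsurj w hw hwI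
      exact absurd (hall r hr) (hb r hr hr').2.2.1
    · obtain ⟨r, hr, hr', rfl⟩ := hsurj w hw hwI
      rwa [(hb r hr hr').2.2.eq_of_not_adj hp h2]
  have hwS : ∀ w ∈ S, ¬ G.Adj w v → w = b q₀ ∨ w = q₀ := by
    intro w hw hwv
    by_cases hwI : w ∈ I
    · right
      by_contra hne
      exact hwv (hq w hwI hw hne v hv hva)
    · obtain ⟨r, hr, hr', rfl⟩ := hsurj w hw hwI
      rcases hr' with hrA | rfl
      · exact absurd (hbv r hr hrA) hwv
      · exact Or.inl rfl
  obtain ⟨x, hx, y, hxy⟩ := h.exists_mem_dominatesAllBut v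
  have hx' := hwS x hx hxy.2.2.2.1
  have hyS : y ∉ S := by
    intro hyS
    have := hwS y hyS hxy.2.2.2.2.1
    have := hbq.2.2.1
    have := hxy.1.ne
    have := hxy.1
    grind
  have e1 := hxy.2.2.2.2.2 p₁ (by rintro rfl; exact hvI h₁)
  have e2 := hxy.2.2.2.2.2 a hva.symm
  rcases hx' with rfl | rfl
  · exact ⟨y, hyS, hxy⟩
  · exfalso
    have := h.cover y
    have := hxy.1
    grind

/-- All of `I ∩ S` is adjacent to `B \ {a}`, so only `z` and the `b p` can miss vertices there. If
`z` has no neighbour in `B \ {a}`, every pair of a vertex there uses `z`. Otherwise all of `S \ I`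
becomes adjacent both to `a` and to some `u ∈ A \ I`, and no case of `trichotomy` for `u`, `a`
survives. -/
theorem false_of_alone_of_not_missesOnly (h : G.IsCriticalConfiguration S A B I)
    (ha : a ∈ I) (haB : a ∈ B) (hB : ∀ p ∈ I, p ∈ B → p = a)
    (hA : ∀ p, ∃ p' ∈ I, p' ∈ A ∧ p' ≠ p)
    (hag : ¬ ∃ w ∈ S, w ∉ I ∧ G.MissesOnly I w a)
    (hqg : ∀ q ∈ I, q ∈ S → ¬ ∃ w ∈ S, w ∉ I ∧ G.MissesOnly I w q) {b : V → V} {z : V}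
    (hb : ∀ p ∈ I, p ∈ A → b p ∈ S ∧ b p ∉ I ∧ G.MissesOnly I (b p) p)
    (hsurj : ∀ w ∈ S, w ∉ I → w = z ∨ ∃ p ∈ I, p ∈ A ∧ w = b p) : False := by
  have hs : ∀ a b, G.Adj a b → G.Adj b a := fun _ _ h => h.symm
  have hdl := h.disj_left
  have hdr := h.disj_right
  have hnot := h.not_adj
  have hind := h.indep
  have haS : a ∉ S := fun hS => hdr a hS haB
  have haA : a ∉ A := fun hA => h.disj a hA haB
  obtain ⟨p₀, h₀, h₀A, -⟩ := hA a
  have hq : ∀ q ∈ I, q ∈ S → ∀ t ∈ B, t ≠ a → G.Adj q t := fun q hq hqS =>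
    h.adj_right_of_not_missesOnly ha haB h₀ h₀A hag hq hqS (hqg q hq hqS)
  have hBI : ∀ v ∈ B, v ≠ a → v ∉ I := fun v hv hva hI => hva (hB v hI hv)
  have hmiss : ∀ v ∈ B, v ≠ a → ∀ w ∈ S, ¬ G.Adj w v → w = z ∨ ∃ p ∈ I, p ∈ A ∧ w = b p :=
    fun v hv hva w hw hwv => hsurj w hw fun hwI => hwv (hq w hwI hw v hv hva)
  have hcross' : ∀ v ∈ B, v ≠ a → ∀ p ∈ I, p ∈ A →
      ((∀ q ∈ I, G.Adj z q) ∧ ¬ G.Adj z v ∧ ∀ t ∈ B, t ≠ v → G.Adj z t) ∨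
      ∃ w, (w = z ∨ w = b p) ∧ G.Adj w v ∧ ¬ G.Adj w p ∧ ∀ t ∈ A, t ≠ p → G.Adj w t := by
    intro v hv hva p hp hpA
    obtain ⟨p', hp', hpA', hne⟩ := hA p
    rcases h.cross hp hpA hp' hpA' hne (hBI v hv hva) hv with
      ⟨w, hw, hwI, hall, h2, h3⟩ | ⟨w, hw, hwI, h1, h2, h3⟩
    · rcases hsurj w hw hwI with rfl | ⟨r, hr, hrA, rfl⟩
      · exact Or.inl ⟨hall, h2, h3⟩
      · exact absurd (hall r hr) (hb r hr hrA).2.2.1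
    · refine Or.inr ⟨w, ?_, h1, h2, h3⟩
      rcases hsurj w hw hwI with rfl | ⟨r, hr, hrA, rfl⟩
      · exact Or.inl rfl
      · rw [(hb r hr hrA).2.2.eq_of_not_adj hp h2]
        exact Or.inr rfl
  have hcross : ∀ v ∈ B, v ≠ a → ∀ p ∈ I, p ∈ A →
      ∃ w, (w = z ∨ w = b p) ∧ G.Adj w v ∧ ¬ G.Adj w p ∧ ∀ t ∈ A, t ≠ p → G.Adj w t := by
    intro v hv hva p hp hpA
    -- If `z` were adjacent to all of `I` and of `B \ {v}`, the pair of another `v'` would need some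
    -- `b r`, but `hcross'` at `r` makes `b r` adjacent to `v'`.
    refine (hcross' v hv hva p hp hpA).resolve_left ?_
    rintro ⟨hzI, -, hzB⟩
    obtain ⟨v', hv', hva', hne⟩ := h.exists_ne_right a v
    obtain ⟨x, hx, y, hxy⟩ := h.exists_mem_dominatesAllBut v'
    rcases hmiss v' hv' hva' x hx hxy.2.2.2.1 with rfl | ⟨r, hr, hrA, rfl⟩
    · exact hxy.2.2.2.1 (hzB v' hv' hne)
    · rcases hcross' v' hv' hva' r hr hrA with ⟨-, h2, -⟩ | ⟨w, rfl | rfl, h1, h2, -⟩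
      · exact h2 (hzB v' hv' hne)
      · exact h2 (hzI r hr)
      · exact hxy.2.2.2.1 h1
  by_cases hzB : ∀ v ∈ B, v ≠ a → ¬ G.Adj z v
  · refine h.false_of_forall_dominatesAllBut haB (z := z) fun v hv hva => ?_
    have hwz : ∀ w ∈ S, ¬ G.Adj w v → w = z := by
      intro w hw hwv
      rcases hmiss v hv hva w hw hwv with rfl | ⟨r, hr, hrA, rfl⟩
      · rfl
      · obtain ⟨w, rfl | rfl, h1, -⟩ := hcross v hv hva r hr hrA
        · exact absurd h1 (hzB v hv hva)
        · exact absurd h1 hwv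
    obtain ⟨x, hx, y, hxy⟩ := h.exists_mem_dominatesAllBut v
    obtain rfl := hwz x hx hxy.2.2.2.1
    exact ⟨y, fun hyS => hxy.1.ne (hwz y hyS hxy.2.2.2.2.1).symm, hxy⟩
  push Not at hzB
  obtain ⟨v₁, hv₁, hva₁, hzv₁⟩ := hzB
  obtain ⟨x, hx, y, hxy⟩ := h.exists_mem_dominatesAllBut v₁
  obtain ⟨p₁, h₁, h₁A, rfl⟩ := (hmiss v₁ hv₁ hva₁ x hx hxy.2.2.2.1).resolve_left
    (by rintro rfl; exact hxy.2.2.2.1 hzv₁)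
  obtain ⟨hzp₁, hzA⟩ : ¬ G.Adj z p₁ ∧ ∀ t ∈ A, t ≠ p₁ → G.Adj z t := by
    obtain ⟨w, rfl | rfl, h1, h2⟩ := hcross v₁ hv₁ hva₁ p₁ h₁ h₁A
    · exact h2
    · exact absurd h1 hxy.2.2.2.1
  have hbne : ∀ v ∈ B, v ≠ a → ∀ p ∈ I, p ∈ A → p ≠ p₁ → G.Adj (b p) v := by
    intro v hv hva p hp hpA hne
    obtain ⟨w, rfl | rfl, h1, h2, -⟩ := hcross v hv hva p hp hpA
    · exact absurd (hzA p hpA hne) h2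
    · exact h1
  have hyS : y ∉ S := by
    intro hyS
    rcases hmiss v₁ hv₁ hva₁ y hyS hxy.2.2.2.2.1 with rfl | ⟨r, hr, hrA, rfl⟩
    · exact hxy.2.2.2.2.1 hzv₁
    · by_cases hrp : r = p₁
      · subst hrp
        exact hxy.1.ne rfl
      · exact hxy.2.2.2.2.1 (hbne v₁ hv₁ hva₁ r hr hrA hrp)
  have hbp₁ := (hb p₁ h₁ h₁A).2.2.1
  have hyA : y ∈ A := by
    have := hxy.2.2.2.2.2 p₁ (by rintro rfl; exact hBI _ hv₁ hva₁ h₁)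
    have := h.cover y
    have := hxy.1
    grind
  obtain ⟨v, hv, hva, hvv₁⟩ := h.exists_ne_right a v₁
  have hbv : G.Adj (b p₁) v := by
    have := hxy.2.2.2.2.2 v hvv₁
    have := h.disj y hyA
    grind
  have hwz : ∀ w ∈ S, ¬ G.Adj w v → w = z := by
    intro w hw hwv
    rcases hmiss v hv hva w hw hwv with rfl | ⟨r, hr, hrA, rfl⟩
    · rfl
    · by_cases hrp : r = p₁
      · subst hrp
        exact absurd hbv hwv
      · exact absurd (hbne v hv hva r hr hrA hrp) hwv
  obtain ⟨x', hx', y', hxy'⟩ := h.exists_mem_dominatesAllBut v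
  obtain rfl := hwz x' hx' hxy'.2.2.2.1
  have hyS' : y' ∉ S := fun hyS => hxy'.1.ne (hwz y' hyS hxy'.2.2.2.2.1).symm
  have hyA' : y' ∈ A := by
    have := hxy'.2.2.2.2.2 p₁ (by rintro rfl; exact hBI _ hv hva h₁)
    have := h.cover y'
    have := hxy'.1
    grind
  have hza : G.Adj x' a := by
    have := hxy'.2.2.2.2.2 a hva.symm
    have := h.disj y' hyA'
    grind
  have hbA : ∀ p ∈ I, p ∈ A → ∀ t ∈ A, t ≠ p → G.Adj (b p) t := by
    intro p hp hpA
    obtain ⟨w, rfl | rfl, h1, h2, h3⟩ := hcross v hv hva p hp hpA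
    · exact absurd h1 hxy'.2.2.2.1
    · exact h3
  obtain ⟨u, huA, huI⟩ := h.exists_notMem_left
  have hSu : ∀ w ∈ S, w ∉ I → G.Adj w u := by
    intro w hw hwI
    rcases hsurj w hw hwI with rfl | ⟨r, hr, hrA, rfl⟩
    · exact hzA u huA (by rintro rfl; exact huI h₁)
    · exact hbA r hr hrA u huA (by rintro rfl; exact huI hr)
  have hSa : ∀ w ∈ S, w ∉ I → G.Adj w a := by
    intro w hw hwI
    rcases hsurj w hw hwI with rfl | ⟨r, hr, hrA, rfl⟩
    · exact hza
    · exact (hb r hr hrA).2.2.2 a ha (by rintro rfl; exact haA hrA)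
  obtain ⟨q, hqS, -, -, hqu, -, hqu', -⟩ := h.exists_mem_dominatesAllBut u
  have hqI : q ∈ I := by
    by_contra hqI
    exact hqu' (hSu q hqS hqI)
  have huS : u ∉ S := fun hS => hdl u hS huA
  rcases h.trichotomy u a (by rintro rfl; exact huI ha) (hnot u huA a haB) with hd | ⟨w, hw⟩ | ⟨w, hw⟩
  · have := hd q
    grind
  · have hwS := h.mem_of_dominatesAllBut huS hw
    have hwI : w ∈ I := by
      by_contra hwI
      exact hw.2.2.2.2.1 (hSa w hwS hwI)
    have := hw.2.2.2.2.2 q (by rintro rfl; exact haS hqS)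
    have := hw.1
    grind
  · have hwS := h.mem_of_dominatesAllBut haS hw
    exact hw.2.2.2.2.1 (hSu w hwS (h.notMem_of_dominatesAllBut ha hw))

end alone

section single
variable {a p x y : V}

/-- The case in which `I` has one vertex `a` in `B`, one vertex `p` in `A`, and `y ∈ S` misses
exactly one vertex of `I`, which lies in `S`. -/
theorem false_of_single_of_missesOnly (h : G.IsCriticalConfiguration S A B I)
    (ha : a ∈ I) (haB : a ∈ B) (hp : p ∈ I) (hpA : p ∈ A) (hA : ∀ q ∈ I, q ∈ A → q = p)
    (hx : G.DominatesAllBut a x p) {q₀ : V} (hq₀ : q₀ ∈ I) (hq₀S : q₀ ∈ S)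
    (hy : G.MissesOnly I y q₀) (hsurj : ∀ w ∈ S, w ∉ I → w = x ∨ w = y) : False := by
  have hs : ∀ a b, G.Adj a b → G.Adj b a := fun _ _ h => h.symm
  have hdl := h.disj_left
  have hdr := h.disj_right
  have hnot := h.not_adj
  have hind := h.indep
  have haS : a ∉ S := fun hS => hdr a hS haB
  have haA : a ∉ A := fun hA => h.disj a hA haB
  have hxm := h.missesOnly ha hx
  have hxS := h.mem_of_dominatesAllBut haS hx
  have hya : G.Adj y a := hy.2 a ha (by rintro rfl; exact haS hq₀S)
  have hAI : ∀ v ∈ A, v ≠ p → v ∉ I := fun v hv hvp hI => hvp (hA v hI hv)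
  have hvx : ∀ v ∈ A, v ≠ p → G.Adj x v := by
    intro v hv hvp
    have := hx.2.2.2.2.2 v hvp
    grind
  -- `a` cannot beat `v`: the witness would be `y`, leaving `q₀` undominated. If `v` beats `a`, then
  -- `w ∈ I` because `x` and `y` are adjacent to `a`; so `v` itself dominates the rest of `I`.
  have hadj : ∀ v ∈ A, v ≠ p → G.Adj v p ∧ ∀ q ∈ I, q ∈ S → G.Adj v q := by
    intro v hv hvp
    have hvI := hAI v hv hvp
    have hvS : v ∉ S := fun hS => hdl v hS hv
    rcases h.trichotomy v a (by rintro rfl; exact haA hv) (hnot v hv a haB) with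
      hd | ⟨w, hw⟩ | ⟨w, hw⟩
    · refine ⟨?_, fun q hq hqS => ?_⟩
      · have := hd p
        grind
      · have := hd q
        grind
    · have hwS := h.mem_of_dominatesAllBut hvS hw
      have hwI : w ∈ I := by
        by_contra hwI
        have := hw.2.2.2.2.1
        have := hx.1
        have := hsurj w hwS hwI
        grind
      have := hw.1
      refine ⟨?_, fun q hq hqS => ?_⟩
      · have := hw.2.2.2.2.2 p (by rintro rfl; exact haA hpA)
        grind
      · have := hw.2.2.2.2.2 q (by rintro rfl; exact haS hqS)
        grind
    · exfalso
      have hwS := h.mem_of_dominatesAllBut haS hw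
      have hwI := h.notMem_of_dominatesAllBut ha hw
      have := hw.2.2.2.2.1
      have := hy.1
      have := hvx v hv hvp
      have := hw.2.2.2.2.2 q₀ (by rintro rfl; exact hvI hq₀)
      have := hsurj w hwS hwI
      grind
  refine h.swap.false_of_forall_dominatesAllBut hpA (z := y) fun v hv hvp => ?_
  have hwy : ∀ w ∈ S, ¬ G.Adj w v → w = y := by
    intro w hw hwv
    have := (hadj v hv hvp).2 w
    have := hvx v hv hvp
    have := hsurj w hw
    grind
  obtain ⟨s, hsS, t, hst⟩ := h.exists_mem_dominatesAllBut v
  obtain rfl := hwy s hsS hst.2.2.2.1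
  exact ⟨t, fun htS => hst.1.ne (hwy t htS hst.2.2.2.2.1).symm, hst⟩

/-- If some `v ≠ p` in `A` misses a vertex of `I ∩ S`, then `y` misses `v` and is adjacent to the
rest of `A`; the pair of a further `v'` then forces `y` to miss `v'` too. So only `y` can miss such
a `v`. -/
theorem false_of_single_of_not_missesOnly (h : G.IsCriticalConfiguration S A B I)
    (ha : a ∈ I) (haB : a ∈ B) (hp : p ∈ I) (hpA : p ∈ A) (hA : ∀ q ∈ I, q ∈ A → q = p)
    (hx : G.DominatesAllBut a x p) (hsurj : ∀ w ∈ S, w ∉ I → w = x ∨ w = y) : False := by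
  have hs : ∀ a b, G.Adj a b → G.Adj b a := fun _ _ h => h.symm
  have hdl := h.disj_left
  have hdr := h.disj_right
  have hnot := h.not_adj
  have hind := h.indep
  have haS : a ∉ S := fun hS => hdr a hS haB
  have hpS : p ∉ S := fun hS => hdl p hS hpA
  have haA : a ∉ A := fun hA => h.disj a hA haB
  have hxm := h.missesOnly ha hx
  have hxS := h.mem_of_dominatesAllBut haS hx
  have hAI : ∀ v ∈ A, v ≠ p → v ∉ I := fun v hv hvp hI => hvp (hA v hI hv)
  have hvx : ∀ v ∈ A, v ≠ p → G.Adj x v := by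
    intro v hv hvp
    have := hx.2.2.2.2.2 v hvp
    grind
  have hmiss : ∀ v ∈ A, v ≠ p → ∀ w ∈ S, ¬ G.Adj w v → w = y ∨ w ∈ I := by
    intro v hv hvp w hw hwv
    have := hvx v hv hvp
    have := hsurj w hw
    grind
  have hyv : ∀ v ∈ A, v ≠ p → ∀ q ∈ I, q ∈ S → ¬ G.Adj v q →
      ¬ G.Adj y v ∧ ∀ t ∈ A, t ≠ v → G.Adj y t := by
    intro v hv hvp q hq hqS hvq
    have hvI := hAI v hv hvp
    have hvS : v ∉ S := fun hS => hdl v hS hv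
    have hva : v ≠ a := by rintro rfl; exact haA hv
    have hcase : G.Adj y v ∨ ¬ G.Adj y v ∧ ∀ t ∈ A, t ≠ v → G.Adj y t := by
      rcases h.trichotomy v a hva (hnot v hv a haB) with hd | ⟨w, hw⟩ | ⟨w, hw⟩
      · have := hd q
        grind
      · left
        have hwS := h.mem_of_dominatesAllBut hvS hw
        have := hw.2.2.2.2.2 q (by rintro rfl; exact haS hqS)
        have := hw.1
        have := hw.2.2.2.2.1
        have := hx.1
        have := hsurj w hwS
        grind
      · right
        have hwS := h.mem_of_dominatesAllBut haS hw
        have hwI := h.notMem_of_dominatesAllBut ha hw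
        have hwv := hw.2.2.2.2.1
        obtain rfl : w = y := (hmiss v hv hvp w hwS hwv).resolve_right hwI
        refine ⟨hwv, fun t ht htv => ?_⟩
        have := hw.2.2.2.2.2 t htv
        grind
    refine hcase.resolve_left fun hyv => ?_
    have hwI : ∀ w ∈ S, ¬ G.Adj w v → w ∈ I := by
      intro w hw hwv
      have := hmiss v hv hvp w hw hwv
      grind
    obtain ⟨s, hsS, t, hst⟩ := h.exists_mem_dominatesAllBut v
    have hsI := hwI s hsS hst.2.2.2.1
    have htS : t ∉ S := fun htS => hind s hsI t (hwI t htS hst.2.2.2.2.1) hst.1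
    have := hst.2.2.2.2.2 a hva.symm
    have := hst.2.2.2.2.2 p hvp.symm
    have := hst.1
    have := h.cover t
    grind
  have hJ : ∀ v ∈ A, v ≠ p → ∀ q ∈ I, q ∈ S → G.Adj v q := by
    intro v hv hvp q hq hqS
    by_contra hvq
    obtain ⟨-, hyA⟩ := hyv v hv hvp q hq hqS hvq
    obtain ⟨v', hv', hvp', hne⟩ := h.exists_ne_left p v
    obtain ⟨s, hsS, t, hst⟩ := h.exists_mem_dominatesAllBut v'
    rcases hmiss v' hv' hvp' s hsS hst.2.2.2.1 with rfl | hsI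
    · exact hst.2.2.2.1 (hyA v' hv' hne)
    · exact (hyv v' hv' hvp' s hsI hsS fun e => hst.2.2.2.1 e.symm).1 (hyA v' hv' hne)
  refine h.swap.false_of_forall_dominatesAllBut hpA (z := y) fun v hv hvp => ?_
  have hwy : ∀ w ∈ S, ¬ G.Adj w v → w = y := by
    intro w hw hwv
    have := hJ v hv hvp w
    have := hmiss v hv hvp w hw hwv
    grind
  obtain ⟨s, hsS, t, hst⟩ := h.exists_mem_dominatesAllBut v
  obtain rfl := hwy s hsS hst.2.2.2.1
  exact ⟨t, fun htS => hst.1.ne (hwy t htS hst.2.2.2.2.1).symm, hst⟩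

end single

/-! ### The independent set avoids one side -/

section one_sided

/-- `S \ I` turns out to be completely joined to `B`, so the pair of each `v ∈ B` has its cut vertex
in `I ∩ S`, adjacent to `B` except `v`. Two choices of `v` give two members of `I`, neither of which
beats the other. -/
theorem false_of_subset_of_two (h : G.IsCriticalConfiguration S A B I)
    (hB : ∀ p ∈ I, p ∉ B) (hA : ∀ p, ∃ p' ∈ I, p' ∈ A ∧ p' ≠ p) : False := by
  classical
  have hs : ∀ a b, G.Adj a b → G.Adj b a := fun _ _ h => h.symm
  have hdl := h.disj_left
  have hdr := h.disj_right
  have hnot := h.not_adj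
  have hind := h.indep
  have hBI : ∀ v ∈ B, v ∉ I := fun v hv hI => hB v hI hv
  have hIA : ∀ p ∈ I, p ∉ S → p ∈ A := fun p hp hpS => by
    have := h.cover p
    have := hB p hp
    tauto
  obtain ⟨u₁, -⟩ := h.exists_notMem_left
  obtain ⟨p₁, h₁, h₁A, -⟩ := hA u₁
  have hcross : ∀ v ∈ B, ∀ p ∈ I, p ∈ A →
      ∃ w ∈ S, w ∉ I ∧ G.Adj w v ∧ ¬ G.Adj w p ∧ ∀ t ∈ A, t ≠ p → G.Adj w t := by
    intro v hv p hp hpA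
    obtain ⟨p', hp', hpA', hne⟩ := hA p
    -- A `w` adjacent to all of `I` is nobody's witness, so it fills the one place left when some
    -- `p₀` has no witness. Then `cross` fails at `p₀` with a second vertex of `B`.
    refine (h.cross hp hpA hp' hpA' hne (hBI v hv) hv).resolve_left ?_
    rintro ⟨w, hwS, hwI, hwall, hwv, hwB⟩
    by_cases hgood : ∀ p ∈ I, p ∉ S → ∃ w ∈ S, w ∉ I ∧ G.MissesOnly I w p
    · obtain ⟨b, hb, hsurj⟩ := exists_bijective_choice (T := I \ S) (N := S \ I)
        (Q := fun w p => G.MissesOnly I w p)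
        (fun p hp => by
          obtain ⟨hp, hpS⟩ := Finset.mem_sdiff.1 hp
          obtain ⟨w, hw, hwI, hm⟩ := hgood p hp hpS
          exact ⟨w, Finset.mem_sdiff.2 ⟨hw, hwI⟩, hm⟩)
        (fun w p p' hp _ hw hw' => hw'.eq_of_not_adj (Finset.mem_sdiff.1 hp).1 hw.1)
        h.card_sdiff_eq.le
      obtain ⟨r, hr, rfl⟩ := hsurj w (Finset.mem_sdiff.2 ⟨hwS, hwI⟩)
      exact (hb r hr).2.1 (hwall r (Finset.mem_sdiff.1 hr).1)
    · push Not at hgood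
      obtain ⟨p₀, h₀, h₀S, hbad⟩ := hgood
      have hbad : ¬ ∃ w ∈ S, w ∉ I ∧ G.MissesOnly I w p₀ := by
        rintro ⟨w, h1, h2, h3⟩
        exact hbad w h1 h2 h3
      have h₀A := hIA p₀ h₀ h₀S
      obtain ⟨b, z, hz, hb, hsurj⟩ := exists_almost_bijective_choice (T := (I \ S).erase p₀)
        (N := S \ I) (Q := fun w p => G.MissesOnly I w p)
        (fun p hp => by
          obtain ⟨hne, hp⟩ := Finset.mem_erase.1 hp
          obtain ⟨hp, hpS⟩ := Finset.mem_sdiff.1 hp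
          obtain ⟨w, hw, hwI, hm⟩ :=
            h.exists_dominatesAllBut_of_not_missesOnly h₀ h₀S hbad hp hne hpS
          exact ⟨w, Finset.mem_sdiff.2 ⟨hw, hwI⟩, h.missesOnly h₀ hm⟩)
        (fun w p p' hp _ hw hw' => hw'.eq_of_not_adj
          (Finset.mem_sdiff.1 (Finset.mem_of_mem_erase hp)).1 hw.1)
        (by
          have hm : p₀ ∈ I \ S := Finset.mem_sdiff.2 ⟨h₀, h₀S⟩
          rw [Finset.card_erase_of_mem hm, h.card_sdiff_eq]
          have := Finset.card_pos.2 ⟨_, hm⟩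
          omega)
      simp only [Finset.mem_erase, Finset.mem_sdiff] at hb hsurj
      have hwz : w = z := by
        refine (hsurj w ⟨hwS, hwI⟩).resolve_right ?_
        rintro ⟨r, hr, rfl⟩
        exact (hb r hr).2.1.1 (hwall r hr.2.1)
      subst hwz
      obtain ⟨v', hv', hne', -⟩ := h.exists_ne_right v v
      obtain ⟨p', hp', hpA', hne⟩ := hA p₀
      rcases h.cross h₀ h₀A hp' hpA' hne (hBI v' hv') hv' with
        ⟨w', hwS', hwI', hwall', hwv', -⟩ | ⟨w', hwS', hwI', -, hwp, -⟩
      · rcases hsurj w' ⟨hwS', hwI'⟩ with rfl | ⟨r, hr, rfl⟩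
        · exact hwv' (hwB v' hv' hne')
        · exact (hb r hr).2.1.1 (hwall' r hr.2.1)
      · rcases hsurj w' ⟨hwS', hwI'⟩ with rfl | ⟨r, hr, rfl⟩
        · exact hwp (hwall p₀ h₀)
        · exact hwp ((hb r hr).2.1.2 p₀ h₀ (Ne.symm hr.1))
  obtain ⟨v₁, hv₁, -⟩ := h.exists_ne_right p₁ p₁
  obtain ⟨b, hb, hsurj⟩ := exists_bijective_choice (T := I \ S) (N := S \ I)
    (Q := fun w p => ¬ G.Adj w p ∧ ∀ t ∈ A, t ≠ p → G.Adj w t)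
    (fun p hp => by
      obtain ⟨hp, hpS⟩ := Finset.mem_sdiff.1 hp
      obtain ⟨w, hw, hwI, -, hm⟩ := hcross v₁ hv₁ p hp (hIA p hp hpS)
      exact ⟨w, Finset.mem_sdiff.2 ⟨hw, hwI⟩, hm⟩)
    (fun w p p' hp _ hw hw' => by
      obtain ⟨hp, hpS⟩ := Finset.mem_sdiff.1 hp
      by_contra hne
      exact hw.1 (hw'.2 p (hIA p hp hpS) hne))
    h.card_sdiff_eq.le
  simp only [Finset.mem_sdiff] at hb hsurj
  have hSB : ∀ v ∈ B, ∀ w ∈ S, w ∉ I → G.Adj w v := by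
    intro v hv w hw hwI
    obtain ⟨p, hp, rfl⟩ := hsurj w ⟨hw, hwI⟩
    obtain ⟨w', hw', hwI', h1, h2, -⟩ := hcross v hv p hp.1 (hIA p hp.1 hp.2)
    obtain ⟨r, hr, rfl⟩ := hsurj w' ⟨hw', hwI'⟩
    by_cases hpr : p = r
    · subst hpr
      exact h1
    · exact absurd ((hb r hr).2.2 p (hIA p hp.1 hp.2) hpr) h2
  have hpair : ∀ v ∈ B, ∃ q ∈ I, q ∈ S ∧ ¬ G.Adj q v ∧ ∀ t ∈ B, t ≠ v → G.Adj q t := by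
    intro v hv
    have hwI : ∀ w ∈ S, ¬ G.Adj w v → w ∈ I := fun w hw hwv => by
      by_contra hwI
      exact hwv (hSB v hv w hw hwI)
    obtain ⟨q, hqS, y, hqy⟩ := h.exists_mem_dominatesAllBut v
    have hqI := hwI q hqS hqy.2.2.2.1
    have hyS : y ∉ S := fun hyS => hind q hqI y (hwI y hyS hqy.2.2.2.2.1) hqy.1
    have hyA : y ∈ A := by
      have := hqy.2.2.2.2.2 p₁ (by rintro rfl; exact hBI _ hv h₁)
      have := hqy.1
      have := h.cover y
      grind
    refine ⟨q, hqI, hqS, hqy.2.2.2.1, fun t ht htv => ?_⟩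
    have := hqy.2.2.2.2.2 t htv
    have := h.disj y hyA
    grind
  have hno : ∀ v ∈ B, ∀ q ∈ I, ∀ q' ∈ I, q ∈ S → q' ∈ S → ¬ G.Adj q v →
      ¬ ∃ w, G.DominatesAllBut q w q' := by
    rintro v hv q hq q' hq' hqS hqS' hqv ⟨w, hw⟩
    have hm := h.missesOnly hq hw
    have hwI := h.notMem_of_dominatesAllBut hq hw
    have hwp : ∀ p ∈ I, p ∉ S → G.Adj w p := fun p hp hpS =>
      hm.2 p hp (by rintro rfl; exact hpS hqS')
    have hwS : w ∉ S := by
      intro hwS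
      obtain ⟨r, hr, rfl⟩ := hsurj w ⟨hwS, hwI⟩
      exact (hb r hr).2.1 (hwp r hr.1 hr.2)
    have := hwp p₁ h₁ fun hS => hdl p₁ hS h₁A
    have := hw.2.2.2.2.2 v (by rintro rfl; exact hBI _ hv hq')
    have := h.cover w
    have := h.disj w
    grind
  obtain ⟨v₂, hv₂, hne, -⟩ := h.exists_ne_right v₁ v₁
  obtain ⟨q₁, hq₁, hqS₁, hqv₁, hqB₁⟩ := hpair v₁ hv₁
  obtain ⟨q₂, hq₂, hqS₂, hqv₂, hqB₂⟩ := hpair v₂ hv₂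
  rcases h.exists_dominatesAllBut_of_ne hq₁ hq₂ (by
    rintro rfl
    exact hqv₂ (hqB₁ v₂ hv₂ hne)) with hw | hw
  · exact hno v₁ hv₁ q₁ hq₁ q₂ hq₂ hqS₁ hqS₂ hqv₁ hw
  · exact hno v₂ hv₂ q₂ hq₂ q₁ hq₁ hqS₂ hqS₁ hqv₂ hw

/-- No vertex of `S` is adjacent to `a`, so the pair of any `v ∈ B` has a partner in `A`, and its
cut vertex is adjacent to the rest of `B`. Hence `x` has just one neighbour in `B`, yet the pair of
a nonneighbour `v₂` must use `x`, giving it another. -/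
theorem false_of_subset_of_one (h : G.IsCriticalConfiguration S A B I) {a x : V} (ha : a ∈ I)
    (haA : a ∈ A) (hIS : ∀ p ∈ I, p ≠ a → p ∈ S) (hxS : x ∈ S) (hxI : x ∉ I)
    (hsurj : ∀ w ∈ S, w ∉ I → w = x) : False := by
  have hs : ∀ a b, G.Adj a b → G.Adj b a := fun _ _ h => h.symm
  have hdl := h.disj_left
  have hdr := h.disj_right
  have hnot := h.not_adj
  have hind := h.indep
  have haS : a ∉ S := fun hS => hdl a hS haA
  have haB : a ∉ B := fun hB => h.disj a haA hB
  have hBI : ∀ v ∈ B, v ∉ I := fun v hv hI =>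
    hdr v (hIS v hI (by rintro rfl; exact haB hv)) hv
  have hxv : ∀ v ∈ B, (∀ q ∈ I, q ∈ S → G.Adj v q) → ¬ G.Adj x v := by
    intro v hv hall
    obtain ⟨s, hsS, t, hst⟩ := h.exists_mem_dominatesAllBut v
    have hsv := hst.2.2.2.1
    have hsI : s ∉ I := fun hsI => hsv (hall s hsI hsS).symm
    obtain rfl := hsurj s hsS hsI
    exact hsv
  have hcases : ∀ v ∈ B, (∀ q ∈ I, q ∈ S → G.Adj v q) ∨
      (∃ w, G.DominatesAllBut a w v) ∨ G.DominatesAllBut v x a := by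
    intro v hv
    have hvS : v ∉ S := fun hS => hdr v hS hv
    rcases h.trichotomy a v (by rintro rfl; exact haB hv) (hnot a haA v hv) with
      hd | hw | ⟨w, hw⟩
    · left
      intro q hq hqS
      have := hd q
      grind
    · exact Or.inr (Or.inl hw)
    · have hwS := h.mem_of_dominatesAllBut hvS hw
      by_cases hwI : w ∈ I
      · left
        intro q hq hqS
        have := hw.2.2.2.2.2 q (by rintro rfl; exact haS hqS)
        have := hw.1
        grind
      · obtain rfl := hsurj w hwS hwI
        exact Or.inr (Or.inr hw)
  have hno : ∀ v ∈ B, ¬ ∃ w, G.DominatesAllBut a w v := by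
    rintro v hv ⟨w, hw⟩
    have hwS := h.mem_of_dominatesAllBut haS hw
    obtain rfl := hsurj w hwS (h.notMem_of_dominatesAllBut ha hw)
    have hwB : ∀ t ∈ B, t ≠ v → G.Adj w t := by
      intro t ht htv
      have := hw.2.2.2.2.2 t htv
      grind
    obtain ⟨v', hv', hne, -⟩ := h.exists_ne_right v v
    have h1 := hwB v' hv' hne
    rcases hcases v' hv' with h2 | ⟨w', hw'⟩ | h2
    · exact hxv v' hv' h2 h1
    · obtain rfl := hsurj w' (h.mem_of_dominatesAllBut haS hw')
        (h.notMem_of_dominatesAllBut ha hw')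
      exact hw'.2.2.2.2.1 h1
    · exact h2.2.2.2.2.1 hw.1.symm
  have hcases' : ∀ v ∈ B, (∀ q ∈ I, q ∈ S → G.Adj v q) ∨ G.DominatesAllBut v x a := by
    intro v hv
    have := hcases v hv
    have := hno v hv
    tauto
  obtain ⟨v₁, hv₁, hxv₁⟩ := h.exists_adj_right x hxS
  have hxa : ¬ G.Adj x a :=
    ((hcases' v₁ hv₁).resolve_left fun h1 => hxv v₁ hv₁ h1 hxv₁).2.2.2.2.1
  have hpair : ∀ v ∈ B, ∃ s ∈ S, (s = x ∨ s ∈ I) ∧ ¬ G.Adj s v ∧ ∀ t ∈ B, t ≠ v → G.Adj s t := by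
    intro v hv
    have hav : a ≠ v := by rintro rfl; exact haB hv
    obtain ⟨s, hsS, t, hst⟩ := h.exists_mem_dominatesAllBut v
    have hsa : ∀ w ∈ S, ¬ G.Adj w a := by
      intro w hw hwa
      by_cases hwI : w ∈ I
      · exact hind w hwI a ha hwa
      · exact hxa (hsurj w hw hwI ▸ hwa)
    have h1 := hst.2.2.2.2.2 a hav
    have htA : t ∈ A := by
      have := hsa s hsS
      have := hsa t
      have := hst.1
      have := h.cover t
      grind
    refine ⟨s, hsS, ?_, hst.2.2.2.1, fun t' ht' hne => ?_⟩
    · have := hsurj s hsS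
      tauto
    · have := hst.2.2.2.2.2 t' hne
      have := h.disj t htA
      grind
  have hnot' : ∀ v ∈ B, ∀ q ∈ I, ∀ q' ∈ I, q ∈ S → q' ∈ S → ¬ G.Adj q v →
      ¬ ∃ w, G.DominatesAllBut q w q' := by
    rintro v hv q hq q' hq' hqS hqS' hqv ⟨w, hw⟩
    have hwa := (h.missesOnly hq hw).2 a ha (by rintro rfl; exact haS hqS')
    have hwI := h.notMem_of_dominatesAllBut hq hw
    have hwS : w ∉ S := fun hwS => hxa (hsurj w hwS hwI ▸ hwa)
    have := hw.2.2.2.2.2 v (by rintro rfl; exact hBI _ hv hq')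
    have := h.cover w
    have := h.disj w
    grind
  have htwo : ∀ v ∈ B, ∀ v' ∈ B, v ≠ v' → G.Adj x v → ¬ G.Adj x v' := by
    intro v hv v' hv' hne hxv hxv'
    obtain ⟨q, hqS, hq, hqv, hqB⟩ := hpair v hv
    obtain ⟨q', hqS', hq', hqv', hqB'⟩ := hpair v' hv'
    have hqI : q ∈ I := hq.resolve_left (by rintro rfl; exact hqv hxv)
    have hqI' : q' ∈ I := hq'.resolve_left (by rintro rfl; exact hqv' hxv')
    rcases h.exists_dominatesAllBut_of_ne hqI hqI' (by
      rintro rfl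
      exact hqv' (hqB v' hv' hne.symm)) with hw | hw
    · exact hnot' v hv q hqI q' hqI' hqS hqS' hqv hw
    · exact hnot' v' hv' q' hqI' q hqI hqS' hqS hqv' hw
  obtain ⟨v₂, hv₂, hne₂, -⟩ := h.exists_ne_right v₁ v₁
  obtain ⟨v₃, hv₃, hne₃, hne₃'⟩ := h.exists_ne_right v₁ v₂
  have h2 := htwo v₁ hv₁ v₂ hv₂ hne₂.symm hxv₁
  have h3 := htwo v₁ hv₁ v₃ hv₃ hne₃.symm hxv₁
  have hall := (hcases' v₂ hv₂).resolve_right fun h4 => h2 h4.1.symm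
  obtain ⟨s, hsS, hs', hsv, hsB⟩ := hpair v₂ hv₂
  obtain rfl : s = x := hs'.resolve_right fun hsI => hsv (hall s hsI hsS).symm
  exact h3 (hsB v₃ hv₃ hne₃')

/-- Here `S = I` is independent and every vertex is missed by some cut vertex, so no vertex outside
`S` beats another. Thus any `u ∈ A` and `v ∈ B` dominate `G`, which puts the partner in the pair of
`u` into `B`, where it too misses a cut vertex. -/
theorem false_of_subset (h : G.IsCriticalConfiguration S A B I) (hIS : ∀ p ∈ I, p ∈ S) :
    False := by
  have hs : ∀ a b, G.Adj a b → G.Adj b a := fun _ _ h => h.symm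
  have hdl := h.disj_left
  have hdr := h.disj_right
  have hnot := h.not_adj
  have hind := h.indep
  have hSI : ∀ w ∈ S, w ∈ I := by
    have : I = S := Finset.eq_of_subset_of_card_le hIS h.card_eq.ge
    simp [this]
  have hmiss : ∀ v, ∃ x ∈ S, ¬ G.Adj x v := fun v => by
    obtain ⟨x, hx, y, hxy⟩ := h.exists_mem_dominatesAllBut v
    exact ⟨x, hx, hxy.2.2.2.1⟩
  have hno : ∀ u v, u ∉ S → v ∉ S → ¬ ∃ w, G.DominatesAllBut u w v := by
    rintro u v hu hv ⟨w, hw⟩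
    have hwS := h.mem_of_dominatesAllBut hu hw
    obtain ⟨x, hx, hxu⟩ := hmiss u
    have := hw.2.2.2.2.2 x (by rintro rfl; exact hv hx)
    have := hw.1
    grind
  have hd : ∀ u ∈ A, ∀ v ∈ B, ∀ t, t = u ∨ t = v ∨ G.Adj u t ∨ G.Adj v t := by
    intro u hu v hv
    have huS : u ∉ S := fun hS => hdl u hS hu
    have hvS : v ∉ S := fun hS => hdr v hS hv
    exact (h.trichotomy u v (by rintro rfl; exact h.disj u hu hv) (hnot u hu v hv)).resolve_right
      (not_or.2 ⟨hno u v huS hvS, hno v u hvS huS⟩)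
  obtain ⟨u, hu, -⟩ := h.exists_notMem_left
  obtain ⟨v, hv, -⟩ := h.exists_notMem_right
  obtain ⟨w, hwS, y, hwy⟩ := h.exists_mem_dominatesAllBut u
  have hyS : y ∉ S := fun hyS => hind w (hSI w hwS) y (hSI y hyS) hwy.1
  have hyA : y ∉ A := by
    intro hyA
    have := hd u hu v hv y
    have := hwy.2.2.2.2.1
    have := hwy.2.2.1
    grind
  obtain ⟨x, hx, hxy⟩ := hmiss y
  have h1 := hwy.2.2.2.2.2 x (by rintro rfl; exact hdl x hx hu)
  have := hwy.1
  grind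

end one_sided

/-! ### Assembling the cases -/

theorem false_of_forall_notMem (h : G.IsCriticalConfiguration S A B I)
    (hB : ∀ p ∈ I, p ∉ B) : False := by
  classical
  have hIA : ∀ p ∈ I, p ∉ S → p ∈ A := fun p hp hpS => by
    have := h.cover p
    have := hB p hp
    tauto
  by_cases h0 : ∀ p ∈ I, p ∈ S
  · exact h.false_of_subset h0
  push Not at h0
  obtain ⟨a, ha, haS⟩ := h0
  by_cases h1 : ∃ p ∈ I, p ∈ A ∧ p ≠ a
  · obtain ⟨p, hp, hpA, hpa⟩ := h1
    refine h.false_of_subset_of_two hB fun q => ?_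
    by_cases hqa : a = q
    · subst hqa
      exact ⟨p, hp, hpA, hpa⟩
    · exact ⟨a, ha, hIA a ha haS, hqa⟩
  · have hIS : ∀ p ∈ I, p ≠ a → p ∈ S := fun p hp hpa => by
      by_contra hpS
      exact h1 ⟨p, hp, hIA p hp hpS, hpa⟩
    have hK : I \ S = {a} := by
      ext p
      have := hIS p
      simp only [Finset.mem_sdiff, Finset.mem_singleton]
      constructor
      · tauto
      · rintro rfl
        exact ⟨ha, haS⟩
    have hc := h.card_sdiff_eq
    rw [hK, Finset.card_singleton] at hc
    obtain ⟨x, hx⟩ := Finset.card_eq_one.1 hc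
    have hx' : ∀ w, w ∈ S ∧ w ∉ I ↔ w = x := fun w => by
      rw [← Finset.mem_sdiff, hx, Finset.mem_singleton]
    obtain ⟨hxS, hxI⟩ := (hx' x).2 rfl
    exact h.false_of_subset_of_one ha (hIA a ha haS) hIS hxS hxI
      fun w hw hwI => (hx' w).1 ⟨hw, hwI⟩

/-- `S \ I` has one place more than `I ∩ A` needs. The cases are whether a witness of some `q ∈ I ∩
S` takes it, and whether `I ∩ A` has more than one vertex. -/
theorem false_of_alone (h : G.IsCriticalConfiguration S A B I) {a p : V}
    (ha : a ∈ I) (haB : a ∈ B) (hB : ∀ p ∈ I, p ∈ B → p = a) (hp : p ∈ I) (hpA : p ∈ A)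
    (hag : ¬ ∃ w ∈ S, w ∉ I ∧ G.MissesOnly I w a) : False := by
  classical
  have haS : a ∉ S := fun hS => h.disj_right a hS haB
  have hpS : ∀ p, p ∈ A → p ∉ S := fun p hp hS => h.disj_left p hS hp
  have haA : a ∉ A := fun hA => h.disj a hA haB
  have hbeat : ∀ p ∈ I, p ∈ A → ∃ w ∈ S, w ∉ I ∧ G.DominatesAllBut a w p := fun p hp hpA =>
    h.exists_dominatesAllBut_of_not_missesOnly ha haS hag hp (by rintro rfl; exact haA hpA)
      (hpS p hpA)
  have hgoodA : ∀ p ∈ I, p ∈ A → ∃ w ∈ S \ I, G.MissesOnly I w p := fun p hp hpA => by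
    obtain ⟨w, hw, hwI, hd⟩ := hbeat p hp hpA
    exact ⟨w, Finset.mem_sdiff.2 ⟨hw, hwI⟩, h.missesOnly ha hd⟩
  have hK : I \ S = insert a (I.filter (· ∈ A)) := by
    ext r
    simp only [Finset.mem_sdiff, Finset.mem_insert, Finset.mem_filter]
    constructor
    · rintro ⟨hr, hrS⟩
      rcases (h.cover r).resolve_left hrS with hrA | hrB
      · exact Or.inr ⟨hr, hrA⟩
      · exact Or.inl (hB r hr hrB)
    · rintro (rfl | ⟨hr, hrA⟩)
      · exact ⟨ha, haS⟩
      · exact ⟨hr, hpS r hrA⟩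
  have hcard : (S \ I).card = (I.filter (· ∈ A)).card + 1 := by
    rw [h.card_sdiff_eq, hK, Finset.card_insert_of_notMem]
    simp [haA]
  by_cases hq : ∃ q ∈ I, q ∈ S ∧ ∃ w ∈ S, w ∉ I ∧ G.MissesOnly I w q
  · obtain ⟨q, hq, hqS, hqg⟩ := hq
    have hqA : q ∉ A := h.disj_left q hqS
    obtain ⟨b, hb, hsurj⟩ := exists_bijective_choice (T := insert q (I.filter (· ∈ A)))
      (N := S \ I) (Q := fun w p => G.MissesOnly I w p)
      (fun r hr => by
        simp only [Finset.mem_insert, Finset.mem_filter] at hr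
        rcases hr with rfl | ⟨hr, hrA⟩
        · obtain ⟨w, hw, hwI, hm⟩ := hqg
          exact ⟨w, Finset.mem_sdiff.2 ⟨hw, hwI⟩, hm⟩
        · exact hgoodA r hr hrA)
      (fun w r r' hr _ hw hw' => by
        refine hw'.eq_of_not_adj ?_ hw.1
        simp only [Finset.mem_insert, Finset.mem_filter] at hr
        rcases hr with rfl | ⟨hr, hrA⟩
        · exact hq
        · exact hr)
      (by
        rw [hcard, Finset.card_insert_of_notMem]
        simp [hqA])
    simp only [Finset.mem_insert, Finset.mem_filter, Finset.mem_sdiff] at hb hsurj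
    by_cases hp2 : ∃ p' ∈ I, p' ∈ A ∧ p' ≠ p
    · obtain ⟨p', hp', hpA', hne⟩ := hp2
      refine h.false_of_alone_of_missesOnly ha haB hB (b := b) ?_ hq hqS ?_ ?_
      · intro r
        by_cases hrp : p = r
        · subst hrp
          exact ⟨p', hp', hpA', hne⟩
        · exact ⟨p, hp, hpA, hrp⟩
      · intro r hr hr'
        have := hb r (by tauto)
        tauto
      · intro w hw hwI
        obtain ⟨r, hr, rfl⟩ := hsurj w ⟨hw, hwI⟩
        rcases hr with rfl | ⟨hr, hrA⟩
        · exact ⟨r, hq, Or.inr rfl, rfl⟩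
        · exact ⟨r, hr, Or.inl hrA, rfl⟩
    · push Not at hp2
      obtain ⟨x, hx, hxI, hd⟩ := hbeat p hp hpA
      have hbx : b p = x := by
        obtain ⟨r, hr, rfl⟩ := hsurj x ⟨hx, hxI⟩
        rw [(hb r hr).2.eq_of_not_adj hp hd.2.2.2.2.1]
      refine h.false_of_single_of_missesOnly ha haB hp hpA hp2 hd hq hqS
        (hb q (Or.inl rfl)).2 ?_
      intro w hw hwI
      obtain ⟨r, hr, rfl⟩ := hsurj w ⟨hw, hwI⟩
      rcases hr with rfl | ⟨hr, hrA⟩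
      · exact Or.inr rfl
      · left
        rw [hp2 r hr hrA, hbx]
  · have hqg : ∀ q ∈ I, q ∈ S → ¬ ∃ w ∈ S, w ∉ I ∧ G.MissesOnly I w q := fun q hqI hqS hg =>
      hq ⟨q, hqI, hqS, hg⟩
    by_cases hp2 : ∃ p' ∈ I, p' ∈ A ∧ p' ≠ p
    · obtain ⟨p', hp', hpA', hne⟩ := hp2
      obtain ⟨b, z, -, hb, hsurj⟩ := exists_almost_bijective_choice (T := I.filter (· ∈ A))
        (N := S \ I) (Q := fun w p => G.MissesOnly I w p)
        (fun r hr => hgoodA r (Finset.mem_filter.1 hr).1 (Finset.mem_filter.1 hr).2)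
        (fun w r r' hr _ hw hw' => hw'.eq_of_not_adj (Finset.mem_filter.1 hr).1 hw.1) hcard
      simp only [Finset.mem_filter, Finset.mem_sdiff] at hb hsurj
      refine h.false_of_alone_of_not_missesOnly ha haB hB (b := b) (z := z) ?_ hag hqg ?_ ?_
      · intro r
        by_cases hrp : p = r
        · subst hrp
          exact ⟨p', hp', hpA', hne⟩
        · exact ⟨p, hp, hpA, hrp⟩
      · intro r hr hrA
        have := hb r ⟨hr, hrA⟩
        tauto
      · intro w hw hwI
        rcases hsurj w ⟨hw, hwI⟩ with rfl | ⟨r, hr, rfl⟩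
        · exact Or.inl rfl
        · exact Or.inr ⟨r, hr.1, hr.2, rfl⟩
    · push Not at hp2
      obtain ⟨x, hx, hxI, hd⟩ := hbeat p hp hpA
      have hone : I.filter (· ∈ A) = {p} := by
        ext r
        simp only [Finset.mem_filter, Finset.mem_singleton]
        constructor
        · exact fun hr => hp2 r hr.1 hr.2
        · rintro rfl
          exact ⟨hp, hpA⟩
      have hc : ((S \ I).erase x).card = 1 := by
        rw [Finset.card_erase_of_mem (Finset.mem_sdiff.2 ⟨hx, hxI⟩), hcard, hone,
          Finset.card_singleton]
      obtain ⟨y, hy⟩ := Finset.card_eq_one.1 hc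
      refine h.false_of_single_of_not_missesOnly (y := y) ha haB hp hpA hp2 hd fun w hw hwI => ?_
      by_cases hwx : w = x
      · exact Or.inl hwx
      · right
        rw [← Finset.mem_singleton, ← hy]
        exact Finset.mem_erase.2 ⟨hwx, Finset.mem_sdiff.2 ⟨hw, hwI⟩⟩

theorem false_of_not_missesOnly (h : G.IsCriticalConfiguration S A B I) {a p : V}
    (ha : a ∈ I) (haB : a ∈ B) (hp : p ∈ I) (hpA : p ∈ A)
    (hag : ¬ ∃ w ∈ S, w ∉ I ∧ G.MissesOnly I w a) : False := by
  have haS : a ∉ S := fun hS => h.disj_right a hS haB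
  by_cases hJ : ∀ q ∈ I, q ∉ S
  · exact h.swap.false_of_disjoint hJ ha haB hp hpA hag
  push Not at hJ
  obtain ⟨q, hq, hqS⟩ := hJ
  by_cases hB : ∀ p ∈ I, p ∈ B → p = a
  · exact h.false_of_alone ha haB hB hp hpA hag
  push Not at hB
  obtain ⟨p₂, h₂, h₂B, h₂a⟩ := hB
  exact h.false_of_both_sides ha haS hag hp hpA (by rintro rfl; exact h.disj p hpA haB)
    h₂ h₂B h₂a hq hqS

theorem false_of_one_one (h : G.IsCriticalConfiguration S A B I) {b : V → V}
    (hb : ∀ p ∈ I, p ∉ S → b p ∈ S ∧ b p ∉ I ∧ G.MissesOnly I (b p) p)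
    (hsurj : ∀ w ∈ S, w ∉ I → ∃ p ∈ I, p ∉ S ∧ w = b p) {p q : V}
    (hp : p ∈ I) (hpA : p ∈ A) (hq : q ∈ I) (hqB : q ∈ B) (hA : ∀ r ∈ I, r ∈ A → r = p)
    (hB : ∀ r ∈ I, r ∈ B → r = q) (hd : ∃ w, G.DominatesAllBut p w q) : False := by
  obtain ⟨x, hx⟩ := hd
  have hpS : p ∉ S := fun hS => h.disj_left p hS hpA
  have hbx : b q = x := by
    obtain ⟨r, hr, hrS, rfl⟩ := hsurj x (h.mem_of_dominatesAllBut hpS hx)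
      (h.notMem_of_dominatesAllBut hp hx)
    rw [(hb r hr hrS).2.2.eq_of_not_adj hq hx.2.2.2.2.1]
  obtain ⟨hyS, hyI, hy⟩ := hb p hp hpS
  refine h.false_of_bijective_of_one_one hp hpA hq hqB hB hyS hyI hx hy fun w hw hwI => ?_
  obtain ⟨r, hr, hrS, rfl⟩ := hsurj w hw hwI
  rcases (h.cover r).resolve_left hrS with hrA | hrB
  · right
    rw [hA r hr hrA]
  · left
    rw [hB r hr hrB, hbx]

theorem elim (h : G.IsCriticalConfiguration S A B I) : False := by
  classical
  by_cases hB : ∀ p ∈ I, p ∉ B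
  · exact h.false_of_forall_notMem hB
  by_cases hA : ∀ p ∈ I, p ∉ A
  · exact h.swap.false_of_forall_notMem hA
  push Not at hA hB
  obtain ⟨p, hp, hpA⟩ := hA
  obtain ⟨q, hq, hqB⟩ := hB
  by_cases hgood : ∀ r ∈ I, r ∉ S → ∃ w ∈ S, w ∉ I ∧ G.MissesOnly I w r
  · obtain ⟨b, hb, hsurj⟩ := exists_bijective_choice (T := I \ S) (N := S \ I)
      (Q := fun w r => G.MissesOnly I w r)
      (fun r hr => by
        obtain ⟨hr, hrS⟩ := Finset.mem_sdiff.1 hr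
        obtain ⟨w, hw, hwI, hm⟩ := hgood r hr hrS
        exact ⟨w, Finset.mem_sdiff.2 ⟨hw, hwI⟩, hm⟩)
      (fun w r r' hr _ hw hw' => hw'.eq_of_not_adj (Finset.mem_sdiff.1 hr).1 hw.1)
      h.card_sdiff_eq.le
    have hb' : ∀ r ∈ I, r ∉ S → b r ∈ S ∧ b r ∉ I ∧ G.MissesOnly I (b r) r := fun r hr hrS => by
      have := hb r (Finset.mem_sdiff.2 ⟨hr, hrS⟩)
      rw [Finset.mem_sdiff] at this
      tauto
    have hsurj' : ∀ w ∈ S, w ∉ I → ∃ r ∈ I, r ∉ S ∧ w = b r := fun w hw hwI => by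
      obtain ⟨r, hr, e⟩ := hsurj w (Finset.mem_sdiff.2 ⟨hw, hwI⟩)
      obtain ⟨hr, hrS⟩ := Finset.mem_sdiff.1 hr
      exact ⟨r, hr, hrS, e⟩
    by_cases hA2 : ∀ r ∈ I, r ∈ A → r = p <;> by_cases hB2 : ∀ r ∈ I, r ∈ B → r = q
    · rcases h.exists_dominatesAllBut_of_ne hp hq (by rintro rfl; exact h.disj p hpA hqB)
        with hd | hd
      · exact h.false_of_one_one hb' hsurj' hp hpA hq hqB hA2 hB2 hd
      · exact h.swap.false_of_one_one hb' hsurj' hq hqB hp hpA hB2 hA2 hd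
    · have hB3 : ∀ r, ∃ r' ∈ I, r' ∈ B ∧ r' ≠ r := by grind
      exact h.swap.false_of_bijective_of_two_one hb' hsurj' hB3 hp hpA hA2
    · have hA3 : ∀ r, ∃ r' ∈ I, r' ∈ A ∧ r' ≠ r := by grind
      exact h.false_of_bijective_of_two_one hb' hsurj' hA3 hq hqB hB2
    · have hA3 : ∀ r, ∃ r' ∈ I, r' ∈ A ∧ r' ≠ r := by grind
      have hB3 : ∀ r, ∃ r' ∈ I, r' ∈ B ∧ r' ≠ r := by grind
      exact h.false_of_bijective_of_two_two hb' hsurj' hA3 hB3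
  · push Not at hgood
    obtain ⟨a, ha, haS, hag⟩ := hgood
    have hag' : ¬ ∃ w ∈ S, w ∉ I ∧ G.MissesOnly I w a := by
      rintro ⟨w, h1, h2, h3⟩
      exact hag w h1 h2 h3
    rcases (h.cover a).resolve_left haS with haA | haB
    · exact h.swap.false_of_not_missesOnly ha haA hq hqB hag'
    · exact h.false_of_not_missesOnly ha haB hp hpA hag'

end IsCriticalConfiguration

/-! ### Cuts of size two, and the conclusion -/

/-- With a cut of two vertices there are three pairwise nonadjacent vertices. -/
theorem IsCriticalSeparation.exists_indep_of_card_eq_two {G : SimpleGraph V} {S A B : Finset V}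
    (h : G.IsCriticalSeparation S A B) (hS : S.card = 2) :
    ∃ u v w, u ≠ v ∧ u ≠ w ∧ v ≠ w ∧ ¬ G.Adj u v ∧ ¬ G.Adj u w ∧ ¬ G.Adj v w := by
  classical
  by_contra! hno
  have hs : ∀ a b, G.Adj a b → G.Adj b a := fun _ _ h => h.symm
  obtain ⟨x, y, hxy, rfl⟩ := Finset.card_eq_two.1 hS
  have hdl := h.disj_left
  have hdr := h.disj_right
  have hmiss : ∀ v, ¬ G.Adj x v ∨ ¬ G.Adj y v := by
    intro v
    obtain ⟨s, hsS, t, hst⟩ := h.exists_mem_dominatesAllBut v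
    have h1 := hst.2.2.2.1
    have : s = x ∨ s = y := by simpa using hsS
    grind
  have hone : ∀ s ∈ ({x, y} : Finset V), ∀ a ∈ A, ∀ b ∈ B, G.Adj s a ∨ G.Adj s b := by
    intro s hsS a ha b hb
    by_contra! hc
    exact h.not_adj a ha b hb (hno s a b (by rintro rfl; exact hdl s hsS ha)
      (by rintro rfl; exact hdr s hsS hb) (by rintro rfl; exact h.disj a ha hb) hc.1 hc.2)
  -- If `s` misses a vertex of `A`, it is joined to all of `B`; then a neighbour in `B` of the other
  -- cut vertex is missed by neither, against `hmiss`.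
  have hA : ∀ s ∈ ({x, y} : Finset V), ∀ a ∈ A, G.Adj s a := by
    intro s hsS a ha
    by_contra hsa
    have hB : ∀ b ∈ B, G.Adj s b := fun b hb => (hone s hsS a ha b hb).resolve_left hsa
    have hsS' : s = x ∨ s = y := by simpa using hsS
    rcases hsS' with rfl | rfl
    · obtain ⟨b, hb, hyb⟩ := h.exists_adj_right y (by simp)
      have := hmiss b
      have := hB b hb
      tauto
    · obtain ⟨b, hb, hyb⟩ := h.exists_adj_right x (by simp)
      have := hmiss b
      have := hB b hb
      tauto
  obtain ⟨a, ha, -⟩ := h.exists_ne_left x x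
  have h1 := hA x (by simp) a ha
  have h2 := hA y (by simp) a ha
  have := hmiss a
  tauto

theorem vertexConnectivity_le_minDegree [Fintype V] (G : SimpleGraph V) [DecidableRel G.Adj] :
    G.vertexConnectivity ≤ G.minDegree := by
  classical
  cases isEmpty_or_nonempty V
  · have h : G.vertexConnectivity ≤ 0 :=
      Nat.sInf_le ⟨∅, Finset.card_empty, Or.inr Set.subsingleton_of_subsingleton⟩
    exact h.trans (Nat.zero_le _)
  obtain ⟨v, hv⟩ := G.exists_minimal_degree_vertex
  rw [hv, ← card_neighborFinset_eq_degree]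
  refine Nat.sInf_le ⟨G.neighborFinset v, rfl, ?_⟩
  by_cases h : ∃ u, u ≠ v ∧ ¬ G.Adj v u
  · obtain ⟨u, hu, hvu⟩ := h
    exact Or.inl (isVertexCutSet_of_closed (A := (· = v))
      (fun a b ha hb hab => absurd (by simpa [← ha] using hab) hb) rfl (by simp) hu
      (by simpa using hvu))
  · push Not at h
    right
    have : ∀ u ∈ ((G.neighborFinset v : Set V)ᶜ), u = v := fun u hu => by
      by_contra hne
      exact hu (by simpa using h u hne)
    exact fun a ha b hb => (this a ha).trans (this b hb).symm

end SimpleGraph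

open SimpleGraph in
theorem corollary4p6 {V : Type*} [Fintype V] (G : SimpleGraph V) [DecidableRel G.Adj]
    (hG : G.IsMaximalVertexCritical 3) (hα : G.indepNum = G.vertexConnectivity) :
    G.vertexConnectivity = G.minDegree := by
  classical
  refine le_antisymm G.vertexConnectivity_le_minDegree ?_
  by_contra! hlt
  obtain ⟨S, A, B, hS, h⟩ := exists_isCriticalSeparation hG hlt
  have h2 : 2 ≤ G.vertexConnectivity := hG.2.1
  -- Connectivity two is treated apart because the main argument needs a third member of `I`.
  rcases h2.eq_or_lt with h2 | h2
  · obtain ⟨u, v, w, huv, huw, hvw, h1, h3, h4⟩ := h.exists_indep_of_card_eq_two (by omega)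
    have hind : G.IsIndepSet (({u, v, w} : Finset V) : Set V) := by
      have := G.adj_comm
      intro a ha b hb _
      simp only [Finset.coe_insert, Finset.coe_singleton, Set.mem_insert_iff,
        Set.mem_singleton_iff] at ha hb
      rcases ha with rfl | rfl | rfl <;> rcases hb with rfl | rfl | rfl <;> simp_all
    have := hind.card_le_indepNum
    rw [Finset.card_eq_three.2 ⟨u, v, w, huv, huw, hvw, rfl⟩] at this
    omega
  · obtain ⟨I, hI⟩ := G.exists_isNIndepSet_indepNum
    have hcard := hI.card_eq
    refine IsCriticalConfiguration.elim (S := S) (A := A) (B := B) (I := I)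
      ⟨h, fun p hp q hq hpq => ?_, by omega, by omega⟩
    exact hI.isIndepSet hp hq hpq.ne hpq
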